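/- Let $P_Y$ be a distribution on $\{0,1\}$ with $0<P_Y(0)<1$ and entropy $H(P_Y)$ (in bits); $P_Y^n$ is the law of $n$ iid bits, $D(\cdot\Vert\cdot)$ is informational divergence in bits, and $B^m$ denotes $m$ independent uniform bits. *Achievable rates.* A (possibly random) encoder $\{0,1\}^{m}\to\{0,1\}^n$ with output $\tilde Y^n$ for input $B^m$, and a decoder $\{0,1\}^n\to\{0,1\}^m$ with estimate $\hat B^m$, are given for each $n$, where $m=m(n)$. The sequence achieves the rate $R$ if, as $n\to\infty$, $m/n\to R$, $D(P_{\tilde Y^n}\Vert P_Y^n)/n\to0$ and $\Pr[B^m\ne\hat B^m]\to0$. A rate is achievable if some sequence achieves it. *Construction.* Let $h:\{0,1\}^j\to\{0,1\}^+$ be a prefix-free one-to-one fixed-to-variable length code, $U=h(B^j)$ (uniform on the $2^j$ code words), $\ell$ the length, and $P_Y^+(c)=P_Y^{\ell(c)}(c)$. The code is optimal if it minimizes $D(P_U\Vert P_Y^+)/E[\ell(U)]$ among all such codes with the same $j$. Let $h^k(b)$ be the concatenation of the code words of the $k$ blocks of $b\in\{0,1\}^{jk}$. The encoder with output length $n$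 maps $b$ to $h^k(b)$ followed by $n-\ell(h^k(b))$ iid bits with law $P_Y$ if $\ell(h^k(b))\le n$, and to the first $n$ bits of $h^k(b)$ otherwise (overflow). The decoder inverts the encoder on the possible outputs of inputs without overflow, and declares an error otherwise. Let $\mathcal T^k_\epsilon(B^j)$ be the set of $b\in\{0,1\}^{jk}$ in which each $a\in\{0,1\}^j$ occurs among the $k$ blocks with relative frequency in $[(1-\epsilon)2^{-j},(1+\epsilon)2^{-j}]$. *Claims.* 1. For all sufficiently large $j$ an optimal code exists. 2. For every $\epsilon>0$, every $j$ and every such code $h$: the decoder is well defined, i.e. it returns $b$ on every possible output of an input $b$ without overflow, and declares an error on the output of every input with overflow. If $n=(1+\epsilon)kE[\ell(U)]$, or more generally $n$ is an integer with $n\ge(1+\epsilon)kE[\ell(U)]$, then $$\Pr[B^{jk}\neq\hat B^{jk}]\le\Pr[B^{jk}\notin\mathcal T^k_\epsilon(B^j)],$$ and the right side tends to $0$ as $k\to\infty$; hence so does the error probability for $n=\lceil(1+\epsilon)kE[\ell(U)]\rceil$. The rate $jk/n$ equals $\frac{j}{(1+\epsilon)E[\ell(U)]}$ if $k\ge 1$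 and $n=(1+\epsilon)kE[\ell(U)]$, and for $n=\lceil(1+\epsilon)kE[\ell(U)]\rceil$ it tends to this value as $k\to\infty$. 3. Let $h_j$, $j=0,1,2,\dots$, be such codes with input length $j$ that are optimal for all sufficiently large $j$, and $U_j=h_j(B^j)$. For every $\epsilon>0$, $$\frac{j}{(1+\epsilon)E[\ell(U_j)]}\to\frac{H(P_Y)}{1+\epsilon}\qquad(j\to\infty).$$ Moreover there are $\epsilon_n>0$ with $\epsilon_n\to0$ and integers $j_n,k_n\to\infty$ such that $n=(1+\epsilon_n)k_nE[\ell(U_{j_n})]$ for all sufficiently large $n$, and the encoders and decoders constructed from $h_{j_n}$, $k_n$ and $n$ (with the all-zero word returned in place of a declared error) achieve the rate $H(P_Y)$. 4. $H(P_Y)$ is the largest achievable rate. -/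

import Mathlib

open Filter Topology

noncomputable section

namespace DistMatch

/-- Binary words of length `n`; the bit `0` is `false` and the bit `1` is `true`. -/
abbrev Word (n : ℕ) : Type := Fin n → Bool

/-- Entropy in bits of a distribution on a finite set. -/
def entropyBits {α : Type*} [Fintype α] (P : PMF α) : ℝ :=
  -∑ x, (P x).toReal * Real.logb 2 (P x).toReal

/-- Informational divergence in bits. It is used only for `Q` with full support, where no
infinite value can occur; terms with `P x = 0` contribute `0`. -/
def klBits {α : Type*} [Fintype α] (P Q : PMF α) : ℝ :=
  ∑ x, (P x).toReal * Real.logb 2 ((P x).toReal / (Q x).toReal)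

/-- The product distribution `P_Y^n` of `n` iid bits. -/
def iid (P : PMF Bool) (n : ℕ) : PMF (Word n) :=
  PMF.ofFintype (fun y => ∏ i, P (y i)) (by
    have h : ∑ b, P b = 1 := by rw [← tsum_fintype (L := .unconditional Bool)]; exact P.tsum_coe
    rw [← Fintype.piFinset_univ, ← Finset.prod_univ_sum]
    simp only [h, Finset.prod_const_one])

/-! ### Encoder-decoder pairs and achievable rates -/

/-- The law of the encoder output when the input is `m` independent uniform bits. The encoder is
a random mapping: it sends a word to a distribution on words. -/
def outputLaw {m n : ℕ} (enc : Word m → PMF (Word n)) : PMF (Word n) :=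
  (PMF.uniformOfFintype (Word m)).bind enc

/-- The probability that the decoder does not return the input, for `m` independent uniform
input bits. The value `none` of the decoder stands for a declared error. -/
def errorProb {m n : ℕ} (enc : Word m → PMF (Word n)) (dec : Word n → Option (Word m)) : ℝ :=
  ∑ b : Word m, ((2 : ℝ) ^ m)⁻¹ * ∑ v with dec v ≠ some b, (enc b v).toReal

/-- The sequence of encoder-decoder pairs, with `m n` input bits and `n` output bits, achieves
the matching rate `R` for the target distribution `P`. -/
def AchievesRate (P : PMF Bool) (R : ℝ) (m : ℕ → ℕ)
    (enc : ∀ n, Word (m n) → PMF (Word n)) (dec : ∀ n, Word n → Word (m n)) : Prop :=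
  Tendsto (fun n : ℕ => (m n : ℝ) / n) atTop (𝓝 R) ∧
  Tendsto (fun n : ℕ => klBits (outputLaw (enc n)) (iid P n) / n) atTop (𝓝 0) ∧
  Tendsto (fun n : ℕ => errorProb (enc n) (fun v => some (dec n v))) atTop (𝓝 0)

/-- A matching rate is achievable if some sequence of encoder-decoder pairs achieves it. -/
def IsAchievable (P : PMF Bool) (R : ℝ) : Prop :=
  ∃ (m : ℕ → ℕ) (enc : ∀ n, Word (m n) → PMF (Word n)) (dec : ∀ n, Word n → Word (m n)),
    AchievesRate P R m enc dec

/-! ### Fixed-to-variable length codes -/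

/-- A prefix-free fixed-to-variable length code with input length `j`. -/
structure F2VCode (j : ℕ) where
  /-- The code word of an input word. -/
  toFun : Word j → List Bool
  /-- Code words have length at least one. -/
  ne_nil : ∀ b, toFun b ≠ []
  /-- Distinct inputs have code words none of which is a prefix of the other (in particular,
  the code is one-to-one). -/
  prefix_free : ∀ b b', toFun b <+: toFun b' → b = b'

/-- `P_Y^+(c)`: the probability of the string `c` under `ℓ(c)` iid bits. -/
def stringProb (P : PMF Bool) (c : List Bool) : ℝ := (c.map fun y => (P y).toReal).prod

namespace F2VCode

variable {j : ℕ}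

/-- The set of code words. -/
def codebook (h : F2VCode j) : Finset (List Bool) := Finset.univ.image h.toFun

/-- `E[ℓ(U)]`, where `U` is uniform on the `2 ^ j` code words. -/
def meanLength (h : F2VCode j) : ℝ := ∑ c ∈ h.codebook, ((2 : ℝ) ^ j)⁻¹ * c.length

/-- `D(P_U ‖ P_Y^+)` in bits. -/
def divergence (h : F2VCode j) (P : PMF Bool) : ℝ :=
  ∑ c ∈ h.codebook, ((2 : ℝ) ^ j)⁻¹ * Real.logb 2 (((2 : ℝ) ^ j)⁻¹ / stringProb P c)

/-- The code has the least divergence per output bit among all prefix-free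
fixed-to-variable length codes with the same input length. -/
def IsOptimal (h : F2VCode j) (P : PMF Bool) : Prop :=
  ∀ h' : F2VCode j, h.divergence P / h.meanLength ≤ h'.divergence P / h'.meanLength

/-! ### The block-to-block matcher -/

/-- The `i`-th block of length `j` of a word of length `k * j`: its entry `t` is the entry
`i * j + t` of the word. -/
def block {k j : ℕ} (b : Word (k * j)) (i : Fin k) : Word j :=
  fun t => b (finProdFinEquiv (i, t))

/-- `h^k`: the concatenation of the code words of the `k` blocks. -/
def concat (h : F2VCode j) (k : ℕ) (b : Word (k * j)) : List Bool :=
  (List.ofFn fun i => h.toFun (block b i)).flatten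

/-- The string `c` followed by `y`; if `c` is longer than `n`, this is `c` truncated to its first
`n` entries, as `y` then is the empty word. -/
def fill (n : ℕ) (c : List Bool) (y : Word (n - c.length)) : Word n :=
  fun i => if hi : i.1 < c.length then c.get ⟨i.1, hi⟩ else y ⟨i.1 - c.length, by omega⟩

/-- The random mapping `f_n ∘ h^k`: a string shorter than `n` is filled up with iid bits
distributed according to `P`, a longer one is truncated. -/
def encoder (h : F2VCode j) (P : PMF Bool) (k n : ℕ) (b : Word (k * j)) : PMF (Word n) :=
  (iid P (n - (h.concat k b).length)).map (fill n (h.concat k b))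

open Classical in
/-- The decoder: it inverts the encoder on the outputs of the inputs without overflow, and
declares an error (`none`) otherwise. -/
def decoder (h : F2VCode j) (P : PMF Bool) (k n : ℕ) (v : Word n) : Option (Word (k * j)) :=
  if hv : ∃ b, (h.concat k b).length ≤ n ∧ v ∈ (h.encoder P k n b).support
  then some hv.choose else none

/-- The decoder with the all-zero word in place of a declared error. -/
def totalDecoder (h : F2VCode j) (P : PMF Bool) (k n : ℕ) (v : Word n) : Word (k * j) :=
  (h.decoder P k n v).getD fun _ => false

/-- The output length: `(1 + ε) k E[ℓ(U)]`, rounded up to an integer. -/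
def outputLength (h : F2VCode j) (ε : ℝ) (k : ℕ) : ℕ := ⌈(1 + ε) * k * h.meanLength⌉₊

end F2VCode

/-- The words of `k` blocks of length `j` that are `ε`-letter typical with respect to the uniform
distribution on blocks: each block value `a` has relative frequency within `ε P(a)` of `P(a)`,
where `P(a) = 2 ^ (-j)`. -/
def typicalSet (ε : ℝ) (k j : ℕ) : Set (Word (k * j)) :=
  {b | ∀ a : Word j,
    |((Finset.univ.filter fun i : Fin k => F2VCode.block b i = a).card : ℝ) / k - ((2 : ℝ) ^ j)⁻¹|
      ≤ ε * ((2 : ℝ) ^ j)⁻¹}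

/-- The probability that `k * j` independent uniform bits are not typical. -/
def atypicalProb (ε : ℝ) (k j : ℕ) : ℝ :=
  ((typicalSet ε k j)ᶜ.ncard : ℝ) / 2 ^ (k * j)

end DistMatch

end

/-! The engine is one continuity statement, `exists_abs_selfInformation_sub_le`: if a random string
with the Kraft property has small divergence from `P` per expected letter, then its expected
self-information under `P` per expected letter is close to `H(P)`. Self-information is affine in
length and number of ones, so it suffices to show that the mean number of ones is nearly `P(1)`
times the mean length. This follows from Gibbs' inequality for slightly tilted letter distributions
(`mul_mean_count_sub_le`).

For codes: splitting tree nodes until their weight drops below `2 ^ (-j)` gives a code of bounded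
divergence and mean length linear in `j`. Hence the optimal divergence per letter tends to zero, and
it drops below the least self-information of a letter; from then on only finitely many codes
compete, so a minimizer exists. Since the expected self-information equals divergence plus `j`, the
continuity statement gives `j / E[ℓ] → H(P)`.

For the matcher: typical inputs do not overflow, and outputs without overflow are uniquely decodable
by prefix-freeness, so Chebyshev bounds the error. The `k` code words contribute `k` times the
code's divergence, filling contributes none, and an overflow costs at most linearly many bits
(`klBits_outputLaw_le`). A diagonal choice of `ε`, `j`, `k` achieves `H(P)`.

For the converse: at a rate above `H(P)` reliable decoding forces the output out of the small set of
strings of self-information at most `n(H + δ)`, so the mean self-information is too large for a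
vanishing normalized divergence (`le_entropyBits_of_isAchievable`). -/

namespace DistMatch

/-! ### Product weights of strings and the inequalities of Kraft and Gibbs -/

/-- The product of the letter weights of a string. -/
def weight (q : Bool → ℝ) (c : List Bool) : ℝ := (c.map q).prod

lemma weight_nil (q : Bool → ℝ) : weight q [] = 1 := by simp [weight]

lemma weight_cons (q : Bool → ℝ) (b : Bool) (c : List Bool) :
    weight q (b :: c) = q b * weight q c := by simp [weight]

lemma weight_append (q : Bool → ℝ) (c d : List Bool) :
    weight q (c ++ d) = weight q c * weight q d := by simp [weight]

lemma weight_pos {q : Bool → ℝ} (hq : ∀ b, 0 < q b) (c : List Bool) : 0 < weight q c := by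
  induction c with
  | nil => simp [weight_nil]
  | cons b c ih => rw [weight_cons]; exact mul_pos (hq b) ih

lemma log_weight {q : Bool → ℝ} (hq : ∀ b, 0 < q b) (c : List Bool) :
    Real.log (weight q c) =
      c.count true * Real.log (q true) + c.count false * Real.log (q false) := by
  induction c with
  | nil => simp [weight_nil]
  | cons b c ih =>
    rw [weight_cons, Real.log_mul (hq b).ne' (weight_pos hq c).ne', ih]
    cases b <;> simp <;> ring

/-- Splitting by the first letter is the recursion behind Kraft's inequality. -/
lemma sum_list_eq_sum_tails (S : Finset (List Bool)) (hS : [] ∉ S) (f : List Bool → ℝ) :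
    ∑ c ∈ S, f c = ∑ b, ∑ c ∈ S.preimage (List.cons b) (List.cons_injective.injOn),
      f (b :: c) := by
  have hdecomp : S = Finset.univ.biUnion fun b : Bool =>
      (S.preimage (List.cons b) (List.cons_injective.injOn)).image (List.cons b) := by
    ext c
    rcases c with _ | ⟨b, c⟩
    · simpa using hS
    · cases b <;> simp
  conv_lhs => rw [hdecomp]
  rw [Finset.sum_biUnion]
  · refine Finset.sum_congr rfl fun b _ => ?_
    rw [Finset.sum_image (List.cons_injective.injOn)]
  · intro b _ b' _ hbb
    simp only [Function.onFun, Finset.disjoint_left, Finset.mem_image]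
    rintro _ ⟨c, _, rfl⟩ ⟨c', _, h⟩
    exact hbb (by simpa using (List.cons.inj h).1.symm)

/-- **Kraft's inequality** for product weights: the weights of a prefix-free set of strings
sum to at most one. -/
theorem sum_weight_le_one {q : Bool → ℝ} (hq : ∀ b, 0 < q b) (hsum : q false + q true = 1)
    (S : Finset (List Bool)) (hS : ∀ c ∈ S, ∀ c' ∈ S, c <+: c' → c = c') :
    ∑ c ∈ S, weight q c ≤ 1 := by
  suffices H : ∀ (L : ℕ) (S : Finset (List Bool)), (∀ c ∈ S, c.length ≤ L) →
      (∀ c ∈ S, ∀ c' ∈ S, c <+: c' → c = c') → ∑ c ∈ S, weight q c ≤ 1 from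
    H (S.sup List.length) S (fun c hc => Finset.le_sup hc) hS
  intro L
  -- The empty string is a prefix of everything, so a prefix-free set containing it is a singleton.
  have hnil : ∀ S : Finset (List Bool), (∀ c ∈ S, ∀ c' ∈ S, c <+: c' → c = c') → [] ∈ S →
      ∑ c ∈ S, weight q c ≤ 1 := by
    intro S hS h
    have : S ⊆ {[]} := fun c hc => by
      simpa using (hS [] h c hc (List.nil_prefix)).symm
    calc ∑ c ∈ S, weight q c ≤ ∑ c ∈ {[]}, weight q c :=
          Finset.sum_le_sum_of_subset_of_nonneg this fun c _ _ => (weight_pos hq c).le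
      _ = 1 := by simp [weight_nil]
  induction L with
  | zero =>
    intro S hL hS
    by_cases h : [] ∈ S
    · exact hnil S hS h
    · have : S = ∅ := by
        refine Finset.eq_empty_of_forall_notMem fun c hc => h ?_
        have := hL c hc
        rwa [List.length_eq_zero_iff.1 (Nat.le_zero.1 this)] at hc
      simp [this]
  | succ L ih =>
    intro S hL hS
    by_cases h : [] ∈ S
    · exact hnil S hS h
    · rw [sum_list_eq_sum_tails S h]
      have key : ∀ b, ∑ c ∈ S.preimage (List.cons b) (List.cons_injective.injOn),
          weight q (b :: c) ≤ q b := by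
        intro b
        simp only [weight_cons, ← Finset.mul_sum]
        refine mul_le_of_le_one_right (hq b).le (ih _ ?_ ?_)
        · intro c hc
          simpa using hL _ (Finset.mem_preimage.1 hc)
        · intro c hc c' hc' hp
          have := hS _ (Finset.mem_preimage.1 hc) _ (Finset.mem_preimage.1 hc')
            ((List.prefix_cons_inj b).2 hp)
          exact (List.cons.inj this).2
      rw [Fintype.sum_bool]
      linarith [key true, key false]

lemma sub_le_mul_log_div {w r : ℝ} (hw : 0 ≤ w) (hr : 0 < r) : w - r ≤ w * Real.log (w / r) := by
  rcases hw.eq_or_lt with rfl | hw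
  · simp [hr.le]
  · have := Real.one_sub_inv_le_log_of_pos (div_pos hw hr)
    calc w - r = w * (1 - (w / r)⁻¹) := by field_simp
      _ ≤ _ := by gcongr

/-- **Gibbs' inequality.** -/
lemma sum_mul_log_div_nonneg {ι : Type*} [Fintype ι] {w r : ι → ℝ} (hw : ∀ i, 0 ≤ w i)
    (hw1 : ∑ i, w i = 1) (hr : ∀ i, 0 < r i) (hr1 : ∑ i, r i ≤ 1) :
    0 ≤ ∑ i, w i * Real.log (w i / r i) := by
  have : ∑ i, (w i - r i) ≤ ∑ i, w i * Real.log (w i / r i) :=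
    Finset.sum_le_sum fun i _ => sub_le_mul_log_div (hw i) (hr i)
  rw [Finset.sum_sub_distrib] at this
  linarith

/-- The error is in terms of `s` rather than `u`, so that both letters of the tilt below incur the
same loss. -/
lemma sub_two_mul_sq_le_log {u s : ℝ} (hs : |s| ≤ 1 / 2) (hu : |u| ≤ |s|) :
    u - 2 * s ^ 2 ≤ Real.log (1 + u) := by
  have hu2 := abs_le.1 (hu.trans hs)
  have h1 : 0 < 1 + u := by linarith
  have h2 : u ^ 2 ≤ s ^ 2 := sq_le_sq.2 hu
  have h3 : u - 2 * u ^ 2 ≤ 1 - (1 + u)⁻¹ := by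
    rw [← sub_nonneg]
    have : 1 - (1 + u)⁻¹ - (u - 2 * u ^ 2) = u ^ 2 * (1 + 2 * u) / (1 + u) := by
      field_simp; ring
    rw [this]
    exact div_nonneg (mul_nonneg (sq_nonneg u) (by linarith)) h1.le
  linarith [Real.one_sub_inv_le_log_of_pos h1]

/-- A family of strings whose weights sum to at most one for all letter distributions. -/
def IsKraft {ι : Type*} [Fintype ι] (c : ι → List Bool) : Prop :=
  ∀ q : Bool → ℝ, (∀ b, 0 < q b) → q false + q true = 1 → ∑ i, weight q (c i) ≤ 1

/-- Comparing the divergence with that from a tilted letter distribution controls the mean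
number of ones. -/
lemma mul_mean_count_sub_le {ι : Type*} [Fintype ι] {w : ι → ℝ} {c : ι → List Bool}
    (hw : ∀ i, 0 ≤ w i) (hw1 : ∑ i, w i = 1) (hc : IsKraft c) {p : Bool → ℝ}
    (hp : ∀ b, 0 < p b) (hp1 : p false + p true = 1) {s : ℝ} (hs : |s| ≤ 1 / 2) :
    s * (∑ i, w i * (c i).count true - p true * ∑ i, w i * (c i).length) ≤
      ∑ i, w i * Real.log (w i / weight p (c i)) + 2 * s ^ 2 * ∑ i, w i * (c i).length := by
  have hpt := hp true
  have hpf := hp false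
  have hs2 := abs_le.1 hs
  have hu : |s * p false| ≤ |s| := by
    rw [abs_mul, abs_of_pos hpf]
    exact mul_le_of_le_one_right (abs_nonneg s) (by linarith)
  have hv : |-(s * p true)| ≤ |s| := by
    rw [abs_neg, abs_mul, abs_of_pos hpt]
    exact mul_le_of_le_one_right (abs_nonneg s) (by linarith)
  have hu2 := abs_le.1 (hu.trans hs)
  have hv2 := abs_le.1 (hv.trans hs)
  -- The perturbation has mean zero under `p`, so `q` is again a distribution. To first order in
  -- `s`, `log (q / p)` of a string is `s` times (number of ones minus `p true` times length).
  let q : Bool → ℝ := fun b => cond b (p true * (1 + s * p false)) (p false * (1 + -(s * p true)))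
  have hq : ∀ b, 0 < q b := by
    rintro (_ | _)
    · exact mul_pos hpf (by linarith)
    · exact mul_pos hpt (by linarith)
  have hq1 : q false + q true = 1 := by
    change p false * (1 + -(s * p true)) + p true * (1 + s * p false) = 1
    linear_combination hp1
  have hg := sum_mul_log_div_nonneg hw hw1 (fun i => weight_pos hq (c i)) (hc q hq hq1)
  have hlu := sub_two_mul_sq_le_log hs hu
  have hlv := sub_two_mul_sq_le_log hs hv
  have hterm : ∀ i, w i * Real.log (w i / weight q (c i)) +
      s * (w i * (c i).count true - p true * (w i * (c i).length)) ≤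
      w i * Real.log (w i / weight p (c i)) + 2 * s ^ 2 * (w i * (c i).length) := by
    intro i
    rcases (hw i).eq_or_lt with h0 | h0
    · simp [← h0]
    · have hlen : ((c i).length : ℝ) = (c i).count true + (c i).count false := by
        exact_mod_cast (List.count_true_add_count_false (c i)).symm
      rw [Real.log_div h0.ne' (weight_pos hq _).ne', Real.log_div h0.ne' (weight_pos hp _).ne',
        log_weight hq, log_weight hp, hlen]
      have e1 : Real.log (q true) = Real.log (p true) + Real.log (1 + s * p false) :=
        Real.log_mul hpt.ne' (by linarith)
      have e0 : Real.log (q false) = Real.log (p false) + Real.log (1 + -(s * p true)) :=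
        Real.log_mul hpf.ne' (by linarith)
      rw [e1, e0]
      have a1 := mul_le_mul_of_nonneg_left hlu (Nat.cast_nonneg (α := ℝ) ((c i).count true))
      have a0 := mul_le_mul_of_nonneg_left hlv (Nat.cast_nonneg (α := ℝ) ((c i).count false))
      have a2 := mul_le_mul_of_nonneg_left (add_le_add a1 a0) h0.le
      have hpf' : p false = 1 - p true := by linarith
      rw [hpf'] at a2 ⊢
      nlinarith [a2]
  have := Finset.sum_le_sum fun i (_ : i ∈ Finset.univ) => hterm i
  simp only [Finset.sum_add_distrib, ← Finset.mul_sum, Finset.sum_sub_distrib] at this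
  linarith

/-! ### The target distribution -/

lemma toReal_pos_of_lt {P : PMF Bool} (hP0 : 0 < P false) (hP1 : P false < 1) (b : Bool) :
    0 < (P b).toReal := by
  refine ENNReal.toReal_pos ?_ (P.apply_ne_top b)
  cases b
  · exact hP0.ne'
  · intro h
    have h1 : P false + P true = 1 := by
      have := P.tsum_coe
      rw [tsum_fintype, Fintype.sum_bool] at this
      rw [add_comm]; exact this
    rw [h, add_zero] at h1
    exact hP1.ne h1

lemma sum_toReal_eq_one {α : Type*} [Fintype α] (P : PMF α) : ∑ a, (P a).toReal = 1 := by
  rw [← ENNReal.toReal_sum fun a _ => P.apply_ne_top a, ← tsum_fintype (L := .unconditional α),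
    P.tsum_coe, ENNReal.toReal_one]

lemma toReal_false_add_true (P : PMF Bool) : (P false).toReal + (P true).toReal = 1 := by
  have := sum_toReal_eq_one P
  rw [Fintype.sum_bool] at this
  linarith

lemma stringProb_eq_weight (P : PMF Bool) (c : List Bool) :
    stringProb P c = weight (fun b => (P b).toReal) c := rfl

/-- If the divergence per letter from the target distribution is small, then the mean
self-information per letter is close to the entropy. -/
theorem exists_abs_selfInformation_sub_le {P : PMF Bool} (hP : ∀ b, 0 < (P b).toReal) {δ : ℝ}
    (hδ : 0 < δ) : ∃ η > 0, ∀ (ι : Type) [Fintype ι] (w : ι → ℝ) (c : ι → List Bool),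
      (∀ i, 0 ≤ w i) → ∑ i, w i = 1 → IsKraft c →
      ∑ i, w i * Real.logb 2 (w i / stringProb P (c i)) ≤ η * ∑ i, w i * (c i).length →
      |∑ i, w i * -Real.logb 2 (stringProb P (c i)) - entropyBits P * ∑ i, w i * (c i).length|
        ≤ δ * ∑ i, w i * (c i).length := by
  have hl2 : 0 < Real.log 2 := Real.log_pos one_lt_two
  set C : ℝ := |Real.log (P false).toReal - Real.log (P true).toReal| / Real.log 2 with hC
  have hC0 : 0 ≤ C := by positivity
  -- The mean count of ones will be off by at most `4 * s` per letter, and each unit changes the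
  -- self-information by at most `C` bits.
  set s : ℝ := min (1 / 2) (δ / (4 * (C + 1))) with hs
  have hs0 : 0 < s := lt_min (by norm_num) (by positivity)
  have hs1 : s ≤ 1 / 2 := min_le_left _ _
  have hsC : C * (4 * s) ≤ δ := by
    have : s ≤ δ / (4 * (C + 1)) := min_le_right _ _
    rw [le_div_iff₀ (by positivity)] at this
    nlinarith
  -- In nats, this `η` makes the divergence match the quadratic loss `2 * s ^ 2` of the tilt.
  refine ⟨2 * s ^ 2 / Real.log 2, by positivity, ?_⟩
  intro ι _ w c hw hw1 hc hD
  have hp1 := toReal_false_add_true P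
  set E := ∑ i, w i * ((c i).length : ℝ) with hE
  have hE0 : 0 ≤ E := Finset.sum_nonneg fun i _ => mul_nonneg (hw i) (Nat.cast_nonneg _)
  set N := ∑ i, w i * ((c i).count true : ℝ) with hN
  have hDl : ∑ i, w i * Real.log (w i / weight (fun b => (P b).toReal) (c i)) ≤ 2 * s ^ 2 * E := by
    have : ∑ i, w i * Real.log (w i / weight (fun b => (P b).toReal) (c i)) =
        Real.log 2 * ∑ i, w i * Real.logb 2 (w i / stringProb P (c i)) := by
      rw [Finset.mul_sum]
      refine Finset.sum_congr rfl fun i _ => ?_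
      rw [Real.logb, stringProb_eq_weight]
      field_simp
    rw [this]
    calc _ ≤ Real.log 2 * (2 * s ^ 2 / Real.log 2 * E) := by gcongr
      _ = _ := by field_simp
  -- Tilting in both directions bounds the deviation from both sides.
  have hpos := mul_mean_count_sub_le hw hw1 hc (p := fun b => (P b).toReal) hP hp1 (s := s)
    (by rw [abs_of_pos hs0]; exact hs1)
  have hneg := mul_mean_count_sub_le hw hw1 hc (p := fun b => (P b).toReal) hP hp1 (s := -s)
    (by rw [abs_neg, abs_of_pos hs0]; exact hs1)
  simp only [neg_sq] at hneg
  rw [← hE, ← hN] at hpos hneg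
  have habs : |N - (P true).toReal * E| ≤ 4 * s * E := by
    rw [abs_le]
    constructor
    · refine le_of_mul_le_mul_left ?_ hs0
      nlinarith
    · refine le_of_mul_le_mul_left ?_ hs0
      nlinarith
  have hid : ∑ i, w i * -Real.logb 2 (stringProb P (c i)) - entropyBits P * E =
      (N - (P true).toReal * E) *
        ((Real.log (P false).toReal - Real.log (P true).toReal) / Real.log 2) := by
    have h1 : ∀ i, w i * -Real.logb 2 (stringProb P (c i)) =
        (w i * (c i).count true) * ((Real.log (P false).toReal - Real.log (P true).toReal) /
          Real.log 2) - (w i * (c i).length) * (Real.log (P false).toReal / Real.log 2) := by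
      intro i
      have hlen : ((c i).length : ℝ) = (c i).count true + (c i).count false := by
        exact_mod_cast (List.count_true_add_count_false (c i)).symm
      rw [Real.logb, stringProb_eq_weight, log_weight hP, hlen]
      field_simp
      ring
    rw [Finset.sum_congr rfl fun i _ => h1 i, Finset.sum_sub_distrib, ← Finset.sum_mul,
      ← Finset.sum_mul, ← hE, ← hN, entropyBits, Fintype.sum_bool, Real.logb, Real.logb]
    have : (P false).toReal = 1 - (P true).toReal := by linarith
    field_simp
    linear_combination E * Real.log (P false).toReal * hp1
  rw [hid, abs_mul, abs_div, abs_of_pos hl2]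
  calc _ ≤ 4 * s * E * C := by gcongr
    _ = C * (4 * s) * E := by ring
    _ ≤ _ := by gcongr

lemma weight_ofFn (q : Bool → ℝ) {n : ℕ} (v : Word n) :
    weight q (List.ofFn v) = ∏ i, q (v i) := by
  simp [weight, List.map_ofFn, List.prod_ofFn]

lemma sum_weight_ofFn {q : Bool → ℝ} (hq1 : q false + q true = 1) (n : ℕ) :
    ∑ v : Word n, weight q (List.ofFn v) = 1 := by
  have h : ∑ b, q b = 1 := by rw [Fintype.sum_bool]; linarith
  simp only [weight_ofFn]
  rw [← Fintype.piFinset_univ, ← Finset.prod_univ_sum]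
  simp only [h, Finset.prod_const_one]

/-- Lets the continuity statement apply to fixed-length outputs, as the converse needs. -/
lemma isKraft_ofFn (n : ℕ) : IsKraft fun v : Word n => List.ofFn v :=
  fun _ _ hq1 => (sum_weight_ofFn hq1 n).le

lemma weight_le_pow {q : Bool → ℝ} (hq : ∀ b, 0 < q b) {M : ℝ} (hM : ∀ b, q b ≤ M)
    (c : List Bool) : weight q c ≤ M ^ c.length := by
  induction c with
  | nil => simp [weight_nil]
  | cons b c ih =>
    rw [weight_cons, List.length_cons, pow_succ']
    exact mul_le_mul (hM b) ih (weight_pos hq c).le ((hq b).le.trans (hM b))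

lemma pow_le_weight {q : Bool → ℝ} {m : ℝ} (hm0 : 0 ≤ m) (hm : ∀ b, m ≤ q b)
    (c : List Bool) : m ^ c.length ≤ weight q c := by
  induction c with
  | nil => simp [weight_nil]
  | cons b c ih =>
    rw [weight_cons, List.length_cons, pow_succ']
    exact mul_le_mul (hm b) ih (by positivity) (hm0.trans (hm b))

/-! ### Prefix-free codes -/

namespace F2VCode

variable {j : ℕ}

lemma toFun_injective (h : F2VCode j) : Function.Injective h.toFun := fun b b' hb =>
  h.prefix_free b b' (hb ▸ List.prefix_rfl)

lemma sum_codebook (h : F2VCode j) (f : List Bool → ℝ) :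
    ∑ c ∈ h.codebook, f c = ∑ b, f (h.toFun b) := by
  rw [codebook, Finset.sum_image h.toFun_injective.injOn]

lemma isKraft (h : F2VCode j) : IsKraft h.toFun := by
  intro q hq hq1
  rw [← h.sum_codebook]
  refine sum_weight_le_one hq hq1 _ ?_
  intro c hc c' hc' hcc
  obtain ⟨b, -, rfl⟩ := Finset.mem_image.1 hc
  obtain ⟨b', -, rfl⟩ := Finset.mem_image.1 hc'
  rw [h.prefix_free b b' hcc]

lemma sum_uniform (j : ℕ) : ∑ _b : Word j, ((2 : ℝ) ^ j)⁻¹ = 1 := by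
  simp [Finset.sum_const, nsmul_eq_mul]

lemma meanLength_eq (h : F2VCode j) :
    h.meanLength = ∑ b, ((2 : ℝ) ^ j)⁻¹ * (h.toFun b).length :=
  h.sum_codebook fun c => ((2 : ℝ) ^ j)⁻¹ * c.length

lemma divergence_eq (h : F2VCode j) (P : PMF Bool) :
    h.divergence P =
      ∑ b, ((2 : ℝ) ^ j)⁻¹ * Real.logb 2 (((2 : ℝ) ^ j)⁻¹ / stringProb P (h.toFun b)) :=
  h.sum_codebook fun c => ((2 : ℝ) ^ j)⁻¹ * Real.logb 2 (((2 : ℝ) ^ j)⁻¹ / stringProb P c)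

lemma le_meanLength (h : F2VCode j) {x : ℝ} (hx : ∀ b, x ≤ (h.toFun b).length) :
    x ≤ h.meanLength := by
  rw [meanLength_eq, ← Finset.mul_sum]
  have : ((2 : ℝ) ^ j) * x ≤ ∑ b, ((h.toFun b).length : ℝ) := by
    calc _ = ∑ _b : Word j, x := by simp
      _ ≤ _ := Finset.sum_le_sum fun b _ => hx b
  rwa [← div_eq_inv_mul, le_div_iff₀ (by positivity), mul_comm]

lemma one_le_meanLength (h : F2VCode j) : 1 ≤ h.meanLength :=
  h.le_meanLength fun b => by exact_mod_cast List.length_pos_iff.2 (h.ne_nil b)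

lemma meanLength_pos (h : F2VCode j) : 0 < h.meanLength := one_pos.trans_le h.one_le_meanLength

lemma length_le_mul_meanLength (h : F2VCode j) (b : Word j) :
    ((h.toFun b).length : ℝ) ≤ 2 ^ j * h.meanLength := by
  rw [meanLength_eq, ← Finset.mul_sum, mul_inv_cancel_left₀ (by positivity)]
  exact Finset.single_le_sum (f := fun b => ((h.toFun b).length : ℝ))
    (fun _ _ => Nat.cast_nonneg _) (Finset.mem_univ b)

lemma divergence_nonneg (h : F2VCode j) {P : PMF Bool} (hP : ∀ b, 0 < (P b).toReal) :
    0 ≤ h.divergence P := by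
  have := sum_mul_log_div_nonneg (w := fun _ : Word j => ((2 : ℝ) ^ j)⁻¹)
    (fun _ => by positivity) (sum_uniform j) (fun b => weight_pos hP (h.toFun b))
    (h.isKraft _ hP (toReal_false_add_true P))
  rw [divergence_eq]
  simp only [Real.logb, ← mul_div_assoc, ← Finset.sum_div]
  exact div_nonneg this (Real.log_pos one_lt_two).le

lemma logb_uniform_div {x : ℝ} (hx : 0 < x) :
    Real.logb 2 (((2 : ℝ) ^ j)⁻¹ / x) = -j - Real.logb 2 x := by
  rw [Real.logb_div (by positivity) hx.ne', Real.logb_inv, Real.logb_pow, Real.logb_self_eq_one one_lt_two,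
    mul_one]

/-- The uniform law on code words has entropy `j`; this identity turns control of self-information
into control of the rate `j / E[ℓ]`. -/
lemma sum_selfInformation (h : F2VCode j) {P : PMF Bool} (hP : ∀ b, 0 < (P b).toReal) :
    ∑ b, ((2 : ℝ) ^ j)⁻¹ * -Real.logb 2 (stringProb P (h.toFun b)) = h.divergence P + j := by
  have hj : (j : ℝ) = ∑ _b : Word j, ((2 : ℝ) ^ j)⁻¹ * (j : ℝ) := by
    rw [← Finset.sum_mul, sum_uniform, one_mul]
  rw [divergence_eq, hj, ← Finset.sum_add_distrib]
  refine Finset.sum_congr rfl fun b _ => ?_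
  rw [stringProb_eq_weight, logb_uniform_div (weight_pos hP _)]
  ring

/-- The code that puts a zero in front of the input. -/
def trivialCode (j : ℕ) : F2VCode j where
  toFun b := false :: List.ofFn b
  ne_nil b := by simp
  prefix_free b b' hb := by
    rw [List.prefix_cons_inj] at hb
    exact List.ofFn_injective (hb.eq_of_length (by simp))

end F2VCode

/-! ### Near-uniform codes and optimal codes -/

/-- The leaves of the binary tree whose nodes are split as long as their weight is at least `t`. -/
lemma exists_prefixFree_weight_near {p : Bool → ℝ} (hp : ∀ b, 0 < p b)
    (hp1 : p false + p true = 1) {m M t : ℝ} (hm : ∀ b, m ≤ p b) (hM : ∀ b, p b ≤ M)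
    (ht : 0 < t) (L : ℕ) : ∀ q : ℝ, 0 < q → q * M ^ L < t → ∃ S : Finset (List Bool),
      (∀ c ∈ S, ∀ c' ∈ S, c <+: c' → c = c') ∧ ∑ c ∈ S, weight p c = 1 ∧
      ∀ c ∈ S, q * weight p c < t ∧ min q (t * m) ≤ q * weight p c := by
  have leaf : ∀ q : ℝ, q < t → ∃ S : Finset (List Bool),
      (∀ c ∈ S, ∀ c' ∈ S, c <+: c' → c = c') ∧ ∑ c ∈ S, weight p c = 1 ∧
      ∀ c ∈ S, q * weight p c < t ∧ min q (t * m) ≤ q * weight p c := fun q hq =>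
    ⟨{[]}, by simp, by simp [weight_nil], by simp [weight_nil, hq]⟩
  -- Here `q` is the weight of the current node, and `L` bounds the depth still needed to fall below
  -- `t`.
  induction L with
  | zero => intro q _ hqt; exact leaf q (by simpa using hqt)
  | succ L ih =>
    intro q hq hqt
    rcases lt_or_ge q t with h | h
    · exact leaf q h
    have hch : ∀ b, ∃ S : Finset (List Bool),
        (∀ c ∈ S, ∀ c' ∈ S, c <+: c' → c = c') ∧ ∑ c ∈ S, weight p c = 1 ∧
        ∀ c ∈ S, q * p b * weight p c < t ∧ min (q * p b) (t * m) ≤ q * p b * weight p c := by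
      intro b
      refine ih (q * p b) (mul_pos hq (hp b)) (lt_of_le_of_lt ?_ hqt)
      have hM0 : 0 ≤ M := (hp b).le.trans (hM b)
      calc q * p b * M ^ L ≤ q * M * M ^ L := by gcongr; exact hM b
        _ = _ := by ring
    choose S hpf hsum hS using hch
    refine ⟨Finset.univ.biUnion fun b => (S b).image (List.cons b), ?_, ?_, ?_⟩
    · intro c hc c' hc' hcc
      simp only [Finset.mem_biUnion, Finset.mem_univ, true_and, Finset.mem_image] at hc hc'
      obtain ⟨b, d, hd, rfl⟩ := hc
      obtain ⟨b', d', hd', rfl⟩ := hc'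
      obtain ⟨rfl, hdd⟩ := List.cons_prefix_cons.1 hcc
      rw [hpf b d hd d' hd' hdd]
    · rw [Finset.sum_biUnion]
      · simp only [Finset.sum_image (List.cons_injective.injOn), weight_cons, ← Finset.mul_sum,
          hsum, mul_one, Fintype.sum_bool]
        linarith
      · intro b _ b' _ hbb
        simp only [Function.onFun, Finset.disjoint_left, Finset.mem_image]
        rintro _ ⟨c, _, rfl⟩ ⟨c', _, h⟩
        exact hbb (by simpa using (List.cons.inj h).1.symm)
    · intro c hc
      simp only [Finset.mem_biUnion, Finset.mem_univ, true_and, Finset.mem_image] at hc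
      obtain ⟨b, d, hd, rfl⟩ := hc
      obtain ⟨h1, h2⟩ := hS b d hd
      rw [weight_cons, ← mul_assoc]
      -- A node that is split has weight at least `t`, so its children have weight at least `t * m`.
      refine ⟨h1, le_trans (le_min ?_ (min_le_right _ _)) h2⟩
      refine (min_le_right _ _).trans ?_
      calc t * m ≤ t * p b := by gcongr; exact hm b
        _ ≤ q * p b := by gcongr; exact (hp b).le

namespace F2VCode

/-- There is a code all of whose code words have nearly the probability `2 ^ (-j)`. -/
lemma exists_near_uniform {P : PMF Bool} (hP : ∀ b, 0 < (P b).toReal) {m : ℝ}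
    (hm0 : 0 < m) (hm : ∀ b, m ≤ (P b).toReal) {j : ℕ} (hj : 0 < j) :
    ∃ h : F2VCode j, ∀ b, stringProb P (h.toFun b) < ((2 : ℝ) ^ j)⁻¹ ∧
      ((2 : ℝ) ^ j)⁻¹ * m ≤ stringProb P (h.toFun b) := by
  have hp1 := toReal_false_add_true P
  have hM1 : ∀ b, (P b).toReal < 1 := by
    rintro (_ | _)
    · linarith [hP true]
    · linarith [hP false]
  set t : ℝ := ((2 : ℝ) ^ j)⁻¹ with ht
  have ht0 : 0 < t := by positivity
  have ht1 : t < 1 := inv_lt_one_of_one_lt₀ (one_lt_pow₀ one_lt_two hj.ne')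
  set M := max (P false).toReal (P true).toReal with hMdef
  have hM : ∀ b, (P b).toReal ≤ M := by
    rintro (_ | _)
    · exact le_max_left _ _
    · exact le_max_right _ _
  obtain ⟨L, hL⟩ := exists_pow_lt_of_lt_one ht0 (max_lt (hM1 false) (hM1 true))
  obtain ⟨S, hpf, hsum, hS⟩ := exists_prefixFree_weight_near hP hp1 hm hM ht0 L 1 one_pos
    (by rwa [one_mul])
  simp only [one_mul] at hS
  -- The leaves have total weight one and each weighs at most `2 ^ (-j)`; any `2 ^ j` of them will
  -- serve as code words.
  have hcard : 2 ^ j ≤ S.card := by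
    have h1 : (1 : ℝ) ≤ S.card * t := by
      rw [← hsum, ← nsmul_eq_mul]
      exact Finset.sum_le_card_nsmul _ _ _ fun c hc => (hS c hc).1.le
    rw [ht, ← div_eq_mul_inv, le_div_iff₀ (by positivity), one_mul] at h1
    exact_mod_cast h1
  obtain ⟨T, hTS, hT⟩ := Finset.exists_subset_card_eq hcard
  have e : Word j ≃ T := Fintype.equivOfCardEq (by simp [hT])
  refine ⟨⟨fun b => (e b).1, ?_, ?_⟩, ?_⟩
  -- The empty string has weight one, too large for a leaf since `t < 1`; this is where `0 < j`
  -- matters.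
  · intro b hb
    have := (hS _ (hTS (e b).2)).1
    rw [hb, weight_nil] at this
    linarith
  · intro b b' hbb
    exact e.injective (Subtype.ext (hpf _ (hTS (e b).2) _ (hTS (e b').2) hbb))
  · intro b
    have h := hS _ (hTS (e b).2)
    refine ⟨h.1, le_trans (le_min ?_ le_rfl) h.2⟩
    exact mul_le_one₀ ht1.le hm0.le ((hm false).trans (hM1 false).le)

/-- For a near-uniform code, with `m` the smaller letter probability and `a = -log m`, the
divergence is at most `a`, while a code word of probability below `2 ^ (-j)` has length at least `j
/ a`. -/
lemma exists_divergence_div_meanLength_le {P : PMF Bool} (hP : ∀ b, 0 < (P b).toReal) :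
    ∃ A : ℝ, ∀ j : ℕ, 0 < j → ∃ h : F2VCode j, h.divergence P / h.meanLength ≤ A / j := by
  have hp1 := toReal_false_add_true P
  set m := min (P false).toReal (P true).toReal with hm
  have hm0 : 0 < m := lt_min (hP false) (hP true)
  have hmb : ∀ b, m ≤ (P b).toReal := by
    rintro (_ | _)
    · exact min_le_left _ _
    · exact min_le_right _ _
  have hm1 : m < 1 := (hmb false).trans_lt (by linarith [hP true])
  have ha : 0 < -Real.logb 2 m := neg_pos.2 (Real.logb_neg one_lt_two hm0 hm1)
  set a := -Real.logb 2 m with hadef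
  refine ⟨a * a, fun j hj => ?_⟩
  obtain ⟨h, hh⟩ := exists_near_uniform hP hm0 hmb hj
  have hj0 : (0 : ℝ) < j := Nat.cast_pos.2 hj
  refine ⟨h, ?_⟩
  have hD : h.divergence P ≤ a := by
    rw [divergence_eq]
    calc _ ≤ ∑ _b : Word j, ((2 : ℝ) ^ j)⁻¹ * a := by
          refine Finset.sum_le_sum fun b _ => ?_
          gcongr
          have hw : 0 < stringProb P (h.toFun b) := weight_pos hP _
          rw [hadef, ← Real.logb_inv]
          refine Real.logb_le_logb_of_le one_lt_two (by positivity) ?_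
          rw [div_le_iff₀ hw, ← div_eq_inv_mul, le_div_iff₀ hm0]
          exact (hh b).2
      _ = a := by rw [← Finset.sum_mul, sum_uniform, one_mul]
  have hE : j / a ≤ h.meanLength := by
    refine h.le_meanLength fun b => ?_
    rw [div_le_iff₀ ha]
    have h1 : m ^ (h.toFun b).length ≤ ((2 : ℝ) ^ j)⁻¹ :=
      (pow_le_weight hm0.le hmb _).trans (hh b).1.le
    have h2 := Real.logb_le_logb_of_le one_lt_two (by positivity) h1
    rw [Real.logb_pow, Real.logb_inv, Real.logb_pow, Real.logb_self_eq_one one_lt_two] at h2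
    rw [hadef]
    linarith
  calc h.divergence P / h.meanLength ≤ a / (j / a) := by gcongr
    _ = a * a / j := by field_simp

/-- No code word is longer than `2 ^ j` times the mean length. -/
lemma finite_meanLength_le (j : ℕ) (K : ℝ) : {h : F2VCode j | h.meanLength ≤ K}.Finite := by
  have hfin : {f : Word j → List Bool | ∀ b, f b ∈ {l : List Bool | l.length ≤ ⌊2 ^ j * K⌋₊}}.Finite :=
    Set.Finite.pi' fun _ => List.finite_length_le _ _
  have hinj : Function.Injective (F2VCode.toFun : F2VCode j → Word j → List Bool) := by
    rintro ⟨f, _, _⟩ ⟨g, _, _⟩ hfg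
    simpa using hfg
  refine (hfin.preimage hinj.injOn).subset fun h hh b => ?_
  refine Nat.le_floor ((h.length_le_mul_meanLength b).trans ?_)
  gcongr
  exact hh

/-- Every letter carries at least `μ = -log M` bits, so the divergence is at least `μ * E[ℓ] - j`. A
code at least as good as `h₀`, whose ratio `r` is below `μ`, thus has mean length at most `j / (μ -
r)`, and finitely many candidates remain. -/
lemma exists_isOptimal_of_lt {P : PMF Bool} (hP : ∀ b, 0 < (P b).toReal) {M : ℝ}
    (hM : ∀ b, (P b).toReal ≤ M) {j : ℕ} (h₀ : F2VCode j)
    (hlt : h₀.divergence P / h₀.meanLength < -Real.logb 2 M) :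
    ∃ h : F2VCode j, h.IsOptimal P := by
  have hM0 : 0 < M := (hP false).trans_le (hM false)
  set μ := -Real.logb 2 M with hμ
  set r := h₀.divergence P / h₀.meanLength with hr
  have hlower : ∀ h : F2VCode j, μ * h.meanLength - j ≤ h.divergence P := by
    intro h
    have : μ * h.meanLength ≤ h.divergence P + j := by
      rw [← h.sum_selfInformation hP, meanLength_eq, Finset.mul_sum]
      refine Finset.sum_le_sum fun b _ => ?_
      rw [mul_left_comm]
      gcongr
      have := Real.logb_le_logb_of_le one_lt_two (weight_pos hP _) (weight_le_pow hP hM (h.toFun b))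
      rw [Real.logb_pow] at this
      rw [hμ, stringProb_eq_weight]
      linarith
    linarith
  have hfin : {h : F2VCode j | h.divergence P / h.meanLength ≤ r}.Finite := by
    refine (finite_meanLength_le j (j / (μ - r))).subset fun h hh => ?_
    have h1 : h.divergence P ≤ r * h.meanLength := (div_le_iff₀ h.meanLength_pos).1 hh
    rw [Set.mem_ofPred_eq, le_div_iff₀ (by linarith)]
    linarith [hlower h]
  obtain ⟨h, hh, hmin⟩ := Set.exists_min_image _
    (fun h : F2VCode j => h.divergence P / h.meanLength) hfin ⟨h₀, by rw [Set.mem_ofPred_eq]⟩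
  refine ⟨h, fun h' => ?_⟩
  by_cases hh' : h'.divergence P / h'.meanLength ≤ r
  · exact hmin h' hh'
  · exact le_trans hh (not_le.1 hh').le

theorem eventually_exists_isOptimal {P : PMF Bool} (hP : ∀ b, 0 < (P b).toReal) :
    ∀ᶠ j in atTop, ∃ h : F2VCode j, h.IsOptimal P := by
  have hp1 := toReal_false_add_true P
  set M := max (P false).toReal (P true).toReal with hMdef
  have hM : ∀ b, (P b).toReal ≤ M := by
    rintro (_ | _)
    · exact le_max_left _ _
    · exact le_max_right _ _
  have hM1 : M < 1 := max_lt (by linarith [hP true]) (by linarith [hP false])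
  have hμ : 0 < -Real.logb 2 M :=
    neg_pos.2 (Real.logb_neg one_lt_two ((hP false).trans_le (hM false)) hM1)
  obtain ⟨A, hA⟩ := exists_divergence_div_meanLength_le hP
  have hlim : Tendsto (fun j : ℕ => A / (j : ℝ)) atTop (𝓝 0) :=
    tendsto_const_div_atTop_nhds_zero_nat A
  filter_upwards [hlim.eventually_lt_const hμ, eventually_gt_atTop 0] with j hj hj0
  obtain ⟨h, hh⟩ := hA j hj0
  exact exists_isOptimal_of_lt hP hM h (hh.trans_lt hj)

theorem tendsto_divergence_div_meanLength {P : PMF Bool} (hP : ∀ b, 0 < (P b).toReal)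
    {h : ∀ j, F2VCode j} (hopt : ∀ᶠ j in atTop, (h j).IsOptimal P) :
    Tendsto (fun j => (h j).divergence P / (h j).meanLength) atTop (𝓝 0) := by
  obtain ⟨A, hA⟩ := exists_divergence_div_meanLength_le hP
  refine squeeze_zero' (Eventually.of_forall fun j =>
    div_nonneg ((h j).divergence_nonneg hP) (h j).meanLength_pos.le) ?_
    (tendsto_const_div_atTop_nhds_zero_nat A)
  filter_upwards [hopt, eventually_gt_atTop 0] with j hj hj0
  obtain ⟨h', hh'⟩ := hA j hj0
  exact (hj h').trans hh'

theorem tendsto_div_meanLength {P : PMF Bool} (hP : ∀ b, 0 < (P b).toReal)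
    {h : ∀ j, F2VCode j} (hopt : ∀ᶠ j in atTop, (h j).IsOptimal P) :
    Tendsto (fun j : ℕ => (j : ℝ) / (h j).meanLength) atTop (𝓝 (entropyBits P)) := by
  have hD := tendsto_divergence_div_meanLength hP hopt
  have hX : Tendsto (fun j : ℕ => ((h j).divergence P + j) / (h j).meanLength) atTop
      (𝓝 (entropyBits P)) := by
    rw [Metric.tendsto_nhds]
    intro δ hδ
    obtain ⟨η, hη, H⟩ := exists_abs_selfInformation_sub_le hP (half_pos hδ)
    filter_upwards [hD.eventually_lt_const hη] with j hj
    have hE := (h j).meanLength_pos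
    have := H (Word j) (fun _ => ((2 : ℝ) ^ j)⁻¹) (h j).toFun (fun _ => by positivity)
      (sum_uniform j) (h j).isKraft
    rw [← divergence_eq, ← meanLength_eq, sum_selfInformation _ hP] at this
    have h2 := this ((div_lt_iff₀ hE).1 hj).le
    rw [Real.dist_eq]
    have e : ((h j).divergence P + j) / (h j).meanLength - entropyBits P =
        ((h j).divergence P + j - entropyBits P * (h j).meanLength) / (h j).meanLength := by
      field_simp
    rw [e, abs_div, abs_of_pos hE, div_lt_iff₀ hE]
    exact h2.trans_lt (by gcongr; linarith)
  have := hX.sub hD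
  rw [sub_zero] at this
  refine this.congr fun j => ?_
  rw [← sub_div, add_sub_cancel_left]

end F2VCode
-- Real-valued forms of the iid law and the output law
lemma iid_toReal (P : PMF Bool) (n : ℕ) (v : Word n) :
    (iid P n v).toReal = stringProb P (List.ofFn v) := by
  rw [stringProb_eq_weight, weight_ofFn, iid, PMF.ofFintype_apply, ENNReal.toReal_prod]

lemma outputLaw_toReal {m n : ℕ} (enc : Word m → PMF (Word n)) (v : Word n) :
    (outputLaw enc v).toReal = ∑ b, ((2 : ℝ) ^ m)⁻¹ * (enc b v).toReal := by
  rw [outputLaw, PMF.bind_apply, tsum_fintype, ENNReal.toReal_sum]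
  · refine Finset.sum_congr rfl fun b _ => ?_
    simp [PMF.uniformOfFintype_apply]
  · intro b _
    exact ENNReal.mul_ne_top (PMF.apply_ne_top _ _) (PMF.apply_ne_top _ _)

/-! ### The matcher: decoding, overflow and typical inputs -/

lemma sum_fin_succ_pi {α : Type*} [Fintype α] {k : ℕ} (F : (Fin (k + 1) → α) → ℝ) :
    ∑ f, F f = ∑ x, ∑ f : Fin k → α, F (Fin.cons x f) := by
  rw [← (Fin.consEquiv fun _ => α).sum_comp, Fintype.sum_prod_type]
  rfl

lemma card_mul_sum_sum {α : Type*} [Fintype α] (g : α → ℝ) (k : ℕ) :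
    Fintype.card α * ∑ f : Fin k → α, ∑ i, g (f i) = k * Fintype.card α ^ k * ∑ x, g x := by
  induction k with
  | zero => simp
  | succ k ih =>
    rw [sum_fin_succ_pi]
    simp only [Fin.sum_univ_succ, Fin.cons_zero, Fin.cons_succ, Finset.sum_add_distrib,
      Finset.sum_const, Finset.card_univ, nsmul_eq_mul, ← Finset.mul_sum, Fintype.card_pi,
      Finset.prod_const, Fintype.card_fin]
    push_cast
    linear_combination (Fintype.card α : ℝ) * ih

/-- The variance of a sum of independent centred variables: cross terms vanish. The factor
`Fintype.card α` avoids the exponent `k - 1`. -/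
lemma card_mul_sum_sq_sum {α : Type*} [Fintype α] (g : α → ℝ) (hg : ∑ x, g x = 0) (k : ℕ) :
    Fintype.card α * ∑ f : Fin k → α, (∑ i, g (f i)) ^ 2 =
      k * Fintype.card α ^ k * ∑ x, g x ^ 2 := by
  induction k with
  | zero => simp
  | succ k ih =>
    rw [sum_fin_succ_pi]
    have h1 : ∑ x, ∑ f : Fin k → α, 2 * g x * ∑ i, g (f i) = 0 := by
      simp only [← Finset.mul_sum, ← Finset.sum_mul, hg]
      ring
    simp only [Fin.sum_univ_succ, Fin.cons_zero, Fin.cons_succ, add_sq, Finset.sum_add_distrib,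
      h1]
    simp only [Finset.sum_const, Finset.card_univ, nsmul_eq_mul, ← Finset.mul_sum,
      Fintype.card_pi, Finset.prod_const, Fintype.card_fin]
    push_cast
    linear_combination (Fintype.card α : ℝ) * ih

namespace F2VCode

variable {j : ℕ}

/-- A word of length `k * j` as a sequence of `k` blocks. -/
def blockEquiv (k j : ℕ) : Word (k * j) ≃ (Fin k → Word j) :=
  (finProdFinEquiv.symm.arrowCongr (Equiv.refl Bool)).trans (Equiv.curry _ _ _)

lemma sum_block {k : ℕ} (F : (Fin k → Word j) → ℝ) :
    ∑ b : Word (k * j), F (block b) = ∑ f, F f :=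
  (blockEquiv k j).sum_comp F

lemma ofFn_fill (n : ℕ) (c : List Bool) (y : Word (n - c.length)) :
    List.ofFn (fill n c y) = (c ++ List.ofFn y).take n := by
  apply List.ext_getElem
  · simp; omega
  · intro i h1 h2
    simp only [List.getElem_ofFn, List.getElem_take, fill]
    split_ifs with h
    · rw [List.getElem_append_left h]; rfl
    · rw [List.getElem_append_right (by omega), List.getElem_ofFn]

/-- The first code words are prefixes of a common string, hence comparable, hence equal; cancel them
and induct. -/
lemma eq_of_flatten_prefix (h : F2VCode j) {k : ℕ} (f g : Fin k → Word j)
    (hfg : (List.ofFn fun i => h.toFun (f i)).flatten <+: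
      (List.ofFn fun i => h.toFun (g i)).flatten) : f = g := by
  induction k with
  | zero => exact Subsingleton.elim _ _
  | succ k ih =>
    rw [List.ofFn_succ, List.ofFn_succ, List.flatten_cons, List.flatten_cons] at hfg
    have h0 : f 0 = g 0 := by
      rcases List.prefix_or_prefix_of_prefix ((List.prefix_append _ _).trans hfg)
        (List.prefix_append _ _) with h1 | h1
      · exact h.prefix_free _ _ h1
      · exact (h.prefix_free _ _ h1).symm
    rw [h0, List.prefix_append_right_inj] at hfg
    have := ih (fun i => f i.succ) (fun i => g i.succ) hfg
    funext i
    refine Fin.cases h0 (fun i => congrFun this i) i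

lemma eq_of_concat_prefix (h : F2VCode j) {k : ℕ} {b b' : Word (k * j)}
    (hb : h.concat k b <+: h.concat k b') : b = b' :=
  (blockEquiv k j).injective (h.eq_of_flatten_prefix (block b) (block b') hb)

lemma exists_fill_of_mem_support {h : F2VCode j} {P : PMF Bool} {k n : ℕ} {b : Word (k * j)}
    {v : Word n} (hv : v ∈ (h.encoder P k n b).support) :
    ∃ y, v = fill n (h.concat k b) y := by
  rw [encoder, PMF.mem_support_map_iff] at hv
  obtain ⟨y, _, hy⟩ := hv
  exact ⟨y, hy.symm⟩

lemma concat_prefix_of_mem_support {h : F2VCode j} {P : PMF Bool} {k n : ℕ} {b : Word (k * j)}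
    {v : Word n} (hv : v ∈ (h.encoder P k n b).support) (hn : (h.concat k b).length ≤ n) :
    h.concat k b <+: List.ofFn v := by
  obtain ⟨y, rfl⟩ := exists_fill_of_mem_support hv
  rw [ofFn_fill, List.take_of_length_le (by simp; omega)]
  exact List.prefix_append _ _

lemma prefix_concat_of_mem_support {h : F2VCode j} {P : PMF Bool} {k n : ℕ} {b : Word (k * j)}
    {v : Word n} (hv : v ∈ (h.encoder P k n b).support) (hn : n ≤ (h.concat k b).length) :
    List.ofFn v <+: h.concat k b := by
  obtain ⟨y, rfl⟩ := exists_fill_of_mem_support hv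
  rw [ofFn_fill, List.take_append_of_le_length hn]
  exact List.take_prefix _ _

/-- An output of an input without overflow is not an output of any other input. -/
lemma eq_of_mem_support {h : F2VCode j} {P : PMF Bool} {k n : ℕ} {b b' : Word (k * j)}
    {v : Word n} (hv : v ∈ (h.encoder P k n b).support) (hn : (h.concat k b).length ≤ n)
    (hv' : v ∈ (h.encoder P k n b').support) : b = b' := by
  have hp := concat_prefix_of_mem_support hv hn
  -- With or without overflow of `b'`, the two concatenations are comparable for the prefix order.
  rcases le_total (h.concat k b').length n with hn' | hn'
  · rcases List.prefix_or_prefix_of_prefix hp (concat_prefix_of_mem_support hv' hn') with h1 | h1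
    · exact h.eq_of_concat_prefix h1
    · exact (h.eq_of_concat_prefix h1).symm
  · exact h.eq_of_concat_prefix (hp.trans (prefix_concat_of_mem_support hv' hn'))

theorem decoder_eq_some {h : F2VCode j} {P : PMF Bool} {k n : ℕ} {b : Word (k * j)}
    {v : Word n} (hv : v ∈ (h.encoder P k n b).support) (hn : (h.concat k b).length ≤ n) :
    h.decoder P k n v = some b := by
  have hex : ∃ b, (h.concat k b).length ≤ n ∧ v ∈ (h.encoder P k n b).support := ⟨b, hn, hv⟩
  rw [decoder, dif_pos hex]
  exact congrArg some (eq_of_mem_support hex.choose_spec.2 hex.choose_spec.1 hv)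

theorem decoder_eq_none {h : F2VCode j} {P : PMF Bool} {k n : ℕ} {b : Word (k * j)}
    {v : Word n} (hv : v ∈ (h.encoder P k n b).support) (hn : n < (h.concat k b).length) :
    h.decoder P k n v = none := by
  rw [decoder, dif_neg]
  rintro ⟨b', hn', hv'⟩
  rw [eq_of_mem_support hv' hn' hv] at hn'
  omega

/-- The probability of an overflow. -/
noncomputable def overflowProb (h : F2VCode j) (k n : ℕ) : ℝ :=
  (Finset.univ.filter fun b : Word (k * j) => n < (h.concat k b).length).card / 2 ^ (k * j)

lemma overflowProb_nonneg (h : F2VCode j) (k n : ℕ) : 0 ≤ h.overflowProb k n := by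
  unfold overflowProb; positivity

lemma sum_overflow (h : F2VCode j) (k n : ℕ) (x : ℝ) :
    ∑ b : Word (k * j), ((2 : ℝ) ^ (k * j))⁻¹ * (if n < (h.concat k b).length then x else 0) =
      h.overflowProb k n * x := by
  rw [← Finset.mul_sum, ← Finset.sum_filter, Finset.sum_const, nsmul_eq_mul, overflowProb]
  ring

/-- Stated for a general decoder so as to cover both `decoder` and `totalDecoder`. -/
lemma errorProb_le_overflowProb (h : F2VCode j) (P : PMF Bool) (k n : ℕ)
    {dec : Word n → Option (Word (k * j))}
    (hdec : ∀ b, (h.concat k b).length ≤ n → ∀ v ∈ (h.encoder P k n b).support, dec v = some b) :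
    errorProb (h.encoder P k n) dec ≤ h.overflowProb k n := by
  rw [← mul_one (h.overflowProb k n), ← sum_overflow, errorProb]
  refine Finset.sum_le_sum fun b _ => ?_
  gcongr
  split_ifs with hb
  · rw [← sum_toReal_eq_one (h.encoder P k n b)]
    exact Finset.sum_le_sum_of_subset_of_nonneg (Finset.filter_subset _ _)
      fun _ _ _ => ENNReal.toReal_nonneg
  · refine (Finset.sum_eq_zero fun v hv => ?_).le
    have hv2 := (Finset.mem_filter.1 hv).2
    by_contra hne
    refine hv2 (hdec b (not_lt.1 hb) v ?_)
    rw [PMF.mem_support_iff]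
    intro h0
    exact hne (by simp [h0])

lemma length_concat (h : F2VCode j) {k : ℕ} (b : Word (k * j)) :
    (h.concat k b).length = ∑ i, (h.toFun (block b i)).length := by
  simp [concat, List.length_flatten, List.map_ofFn, List.sum_ofFn]

lemma sum_comp_eq_sum_card {ι α : Type*} [Fintype ι] [Fintype α] [DecidableEq α] (f : ι → α)
    (g : α → ℝ) :
    ∑ i, g (f i) = ∑ a, ((Finset.univ.filter fun i => f i = a).card : ℝ) * g a := by
  rw [← Finset.sum_fiberwise Finset.univ f]
  refine Finset.sum_congr rfl fun a _ => ?_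
  rw [← nsmul_eq_mul, ← Finset.sum_const]
  refine Finset.sum_congr rfl fun i hi => ?_
  rw [(Finset.mem_filter.1 hi).2]

/-- The length is a sum over block values weighted by their counts, each at most `(1 + ε) * k * 2 ^
(-j)`. -/
lemma length_concat_le_of_mem_typicalSet (h : F2VCode j) {ε : ℝ} {k : ℕ} {b : Word (k * j)}
    (hb : b ∈ typicalSet ε k j) :
    ((h.concat k b).length : ℝ) ≤ (1 + ε) * k * h.meanLength := by
  rcases Nat.eq_zero_or_pos k with rfl | hk
  · simp [length_concat]
  have hk0 : (0 : ℝ) < k := Nat.cast_pos.2 hk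
  rw [length_concat, Nat.cast_sum, sum_comp_eq_sum_card (block b)
    (fun a => ((h.toFun a).length : ℝ)), meanLength_eq, Finset.mul_sum]
  refine Finset.sum_le_sum fun a _ => ?_
  have h1 := (abs_le.1 (hb a)).2
  have h2 : ((Finset.univ.filter fun i : Fin k => block b i = a).card : ℝ) / k ≤
      (1 + ε) * ((2 : ℝ) ^ j)⁻¹ := by linarith
  rw [div_le_iff₀ hk0] at h2
  calc _ ≤ (1 + ε) * ((2 : ℝ) ^ j)⁻¹ * k * (h.toFun a).length := by gcongr
    _ = _ := by ring

lemma overflowProb_le_atypicalProb (h : F2VCode j) {ε : ℝ} {k n : ℕ}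
    (hn : (1 + ε) * k * h.meanLength ≤ n) : h.overflowProb k n ≤ atypicalProb ε k j := by
  unfold overflowProb atypicalProb
  gcongr
  rw [← Set.ncard_coe_finset]
  refine Set.ncard_le_ncard ?_ (Set.toFinite _)
  intro b hb hbt
  have h1 := (Finset.mem_filter.1 (Finset.mem_coe.1 hb)).2
  have h2 : ((h.concat k b).length : ℝ) ≤ n := (h.length_concat_le_of_mem_typicalSet hbt).trans hn
  exact absurd (Nat.cast_le.1 h2) (not_le.2 h1)

end F2VCode

lemma atypicalProb_nonneg (ε : ℝ) (k j : ℕ) : 0 ≤ atypicalProb ε k j := by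
  unfold atypicalProb; positivity

open F2VCode in
/-- Chebyshev's inequality for the block frequencies. -/
theorem atypicalProb_le {ε : ℝ} (hε : 0 < ε) {k : ℕ} (hk : 0 < k) (j : ℕ) :
    atypicalProb ε k j ≤ 4 ^ j / (ε ^ 2 * k) := by
  classical
  have hk0 : (0 : ℝ) < k := Nat.cast_pos.2 hk
  set N : ℝ := 2 ^ j with hN
  have hN0 : 0 < N := by positivity
  have hcard : (Fintype.card (Word j) : ℝ) = N := by simp [hN]
  let cnt (a : Word j) (b : Word (k * j)) : ℝ :=
    ((Finset.univ.filter fun i : Fin k => block b i = a).card : ℝ)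
  let bad (a : Word j) : Finset (Word (k * j)) :=
    Finset.univ.filter fun b => ε * N⁻¹ < |cnt a b / k - N⁻¹|
  have hbad : ∀ a, ((bad a).card : ℝ) ≤ N ^ k * N / (ε ^ 2 * k) := by
    intro a
    -- The centred indicator of the block value `a`; its sum of squares `1 - N⁻¹` is bounded by one.
    let g : Word j → ℝ := fun x => (if x = a then 1 else 0) - N⁻¹
    have hg0 : ∑ x, g x = 0 := by
      simp only [g, Finset.sum_sub_distrib, Finset.sum_ite_eq', Finset.mem_univ, if_true,
        Finset.sum_const, Finset.card_univ, nsmul_eq_mul, hcard]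
      rw [mul_inv_cancel₀ hN0.ne', sub_self]
    have hg2 : ∑ x, g x ^ 2 ≤ 1 := by
      have : ∀ x, g x ^ 2 = (if x = a then 1 - 2 * N⁻¹ else 0) + (N⁻¹) ^ 2 := by
        intro x
        simp only [g]
        split_ifs <;> ring
      simp only [this, Finset.sum_add_distrib, Finset.sum_ite_eq', Finset.mem_univ, if_true,
        Finset.sum_const, Finset.card_univ, nsmul_eq_mul, hcard]
      rw [sq, mul_inv_cancel_left₀ hN0.ne']
      linarith [inv_pos.2 hN0]
    have hcnt : ∀ b, ∑ i, g (block b i) = cnt a b - k * N⁻¹ := by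
      intro b
      simp only [g, cnt, Finset.sum_sub_distrib, Finset.sum_boole, Finset.sum_const,
        Finset.card_univ, Fintype.card_fin, nsmul_eq_mul]
    have hmom := card_mul_sum_sq_sum g hg0 k
    rw [hcard, ← sum_block (fun f : Fin k → Word j => (∑ i, g (f i)) ^ 2)] at hmom
    have hmarkov : ((bad a).card : ℝ) * (k * (ε * N⁻¹)) ^ 2 ≤
        ∑ b : Word (k * j), (∑ i, g (block b i)) ^ 2 := by
      rw [← nsmul_eq_mul]
      refine (Finset.card_nsmul_le_sum (bad a) _ _ fun b hb => ?_).trans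
        (Finset.sum_le_sum_of_subset_of_nonneg (Finset.subset_univ _) fun _ _ _ => sq_nonneg _)
      have hb2 : ε * N⁻¹ < |cnt a b / k - N⁻¹| := (Finset.mem_filter.1 hb).2
      rw [hcnt, ← sq_abs (cnt a b - k * N⁻¹)]
      gcongr
      have e : cnt a b - k * N⁻¹ = k * (cnt a b / k - N⁻¹) := by field_simp
      rw [e, abs_mul, abs_of_pos hk0]
      gcongr
    have h3 : N * (((bad a).card : ℝ) * (k * (ε * N⁻¹)) ^ 2) ≤ k * N ^ k * 1 := by
      calc _ ≤ N * ∑ b : Word (k * j), (∑ i, g (block b i)) ^ 2 := by gcongr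
        _ = k * N ^ k * ∑ x, g x ^ 2 := hmom
        _ ≤ _ := by gcongr
    rw [le_div_iff₀ (by positivity)]
    have e : N * (((bad a).card : ℝ) * (k * (ε * N⁻¹)) ^ 2) =
        (bad a).card * (ε ^ 2 * k) * (k / N) := by field_simp
    have e2 : (k : ℝ) * N ^ k * 1 = N ^ k * N * (k / N) := by field_simp
    rw [e, e2] at h3
    exact le_of_mul_le_mul_right h3 (by positivity)
  have hsub : (typicalSet ε k j)ᶜ ⊆ ((Finset.univ.biUnion bad : Finset _) : Set (Word (k * j))) := by
    intro b hb
    by_contra hnot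
    refine hb fun a => ?_
    by_contra ha
    refine hnot (Finset.mem_coe.2 (Finset.mem_biUnion.2 ⟨a, Finset.mem_univ a, ?_⟩))
    exact Finset.mem_filter.2 ⟨Finset.mem_univ b, not_le.1 ha⟩
  -- The union bound over the `N` block values supplies the second factor `2 ^ j` of `4 ^ j`.
  have hle : ((typicalSet ε k j)ᶜ.ncard : ℝ) ≤ N * (N ^ k * N / (ε ^ 2 * k)) := by
    calc ((typicalSet ε k j)ᶜ.ncard : ℝ) ≤ ((Finset.univ.biUnion bad).card : ℝ) := by
          rw [← Set.ncard_coe_finset]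
          exact_mod_cast Set.ncard_le_ncard hsub (Set.toFinite _)
      _ ≤ ∑ a, ((bad a).card : ℝ) := by exact_mod_cast Finset.card_biUnion_le
      _ ≤ ∑ _a : Word j, N ^ k * N / (ε ^ 2 * k) := Finset.sum_le_sum fun a _ => hbad a
      _ = _ := by rw [Finset.sum_const, Finset.card_univ, nsmul_eq_mul, hcard]
  have h4 : (4 : ℝ) ^ j = N * N := by rw [hN, ← mul_pow]; norm_num
  have h5 : (2 : ℝ) ^ (k * j) = N ^ k := by rw [hN, ← pow_mul, mul_comm]
  rw [atypicalProb, h4, h5, div_le_iff₀ (by positivity)]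
  refine hle.trans (le_of_eq ?_)
  ring

theorem tendsto_atypicalProb {ε : ℝ} (hε : 0 < ε) (j : ℕ) :
    Tendsto (fun k => atypicalProb ε k j) atTop (𝓝 0) := by
  refine squeeze_zero' (Eventually.of_forall fun k => atypicalProb_nonneg ε k j) ?_
    (tendsto_const_div_atTop_nhds_zero_nat (4 ^ j / ε ^ 2))
  filter_upwards [eventually_gt_atTop 0] with k hk
  rw [div_div]
  exact atypicalProb_le hε hk j

/-! ### The divergence of the matcher output -/

lemma stringProb_pos {P : PMF Bool} (hP : ∀ b, 0 < (P b).toReal) (c : List Bool) :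
    0 < stringProb P c := weight_pos hP c

lemma stringProb_le_one {P : PMF Bool} (hP : ∀ b, 0 < (P b).toReal) (c : List Bool) :
    stringProb P c ≤ 1 := by
  have hp1 := toReal_false_add_true P
  have := weight_le_pow hP (M := 1)
    (by rintro (_ | _) <;> linarith [hP false, hP true]) c
  rwa [one_pow] at this

lemma toReal_apply_le_one {α : Type*} (Q : PMF α) (a : α) : (Q a).toReal ≤ 1 := by
  have := ENNReal.toReal_mono ENNReal.one_ne_top (Q.coe_le_one a)
  simpa using this

lemma sum_stringProb_ofFn (P : PMF Bool) (n : ℕ) :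
    ∑ v : Word n, stringProb P (List.ofFn v) = 1 :=
  sum_weight_ofFn (toReal_false_add_true P) n

lemma klBits_iid_eq {P : PMF Bool} {n : ℕ} (Q : PMF (Word n)) :
    klBits Q (iid P n) =
      ∑ v, (Q v).toReal * Real.logb 2 ((Q v).toReal / stringProb P (List.ofFn v)) := by
  simp only [klBits, iid_toReal]

lemma klBits_iid_nonneg {P : PMF Bool} (hP : ∀ b, 0 < (P b).toReal) {n : ℕ} (Q : PMF (Word n)) :
    0 ≤ klBits Q (iid P n) := by
  have := sum_mul_log_div_nonneg (w := fun v => (Q v).toReal) (fun _ => ENNReal.toReal_nonneg)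
    (sum_toReal_eq_one Q) (fun v => stringProb_pos hP (List.ofFn v)) (sum_stringProb_ofFn P n).le
  rw [klBits_iid_eq]
  simp only [Real.logb, ← mul_div_assoc, ← Finset.sum_div]
  exact div_nonneg this (Real.log_pos one_lt_two).le

namespace F2VCode

variable {j : ℕ}

lemma fill_injective {n : ℕ} {c : List Bool} (hc : c.length ≤ n) :
    Function.Injective (fill n c) := by
  intro y y' hy
  have h := congrArg List.ofFn hy
  rw [ofFn_fill, ofFn_fill, List.take_of_length_le (by simp; omega),
    List.take_of_length_le (by simp; omega)] at h
  exact List.ofFn_injective (List.append_cancel_left h)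

lemma stringProb_ofFn_of_mem_support {h : F2VCode j} {P : PMF Bool} {k n : ℕ}
    {b : Word (k * j)} {v : Word n} (hv : v ∈ (h.encoder P k n b).support)
    (hn : (h.concat k b).length ≤ n) :
    stringProb P (List.ofFn v) = stringProb P (h.concat k b) * (h.encoder P k n b v).toReal := by
  obtain ⟨y, rfl⟩ := exists_fill_of_mem_support hv
  have he : h.encoder P k n b (fill n (h.concat k b) y) = iid P _ y := by
    rw [encoder, PMF.map_apply, tsum_eq_single y]
    · simp
    · intro y' hy'
      rw [if_neg fun hh => hy' (fill_injective hn hh).symm]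
  rw [he, iid_toReal, ofFn_fill, List.take_of_length_le (by simp; omega)]
  exact weight_append _ _ _

lemma stringProb_concat (h : F2VCode j) (P : PMF Bool) {k : ℕ} (b : Word (k * j)) :
    stringProb P (h.concat k b) = ∏ i, stringProb P (h.toFun (block b i)) := by
  simp [stringProb, concat, List.map_flatten, List.prod_flatten, List.map_ofFn, List.prod_ofFn]

lemma sum_logb_concat (h : F2VCode j) {P : PMF Bool} (hP : ∀ b, 0 < (P b).toReal) (k : ℕ) :
    ∑ b : Word (k * j), ((2 : ℝ) ^ (k * j))⁻¹ *
      Real.logb 2 (((2 : ℝ) ^ (k * j))⁻¹ / stringProb P (h.concat k b)) =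
      k * h.divergence P := by
  set g : Word j → ℝ := fun a => Real.logb 2 (((2 : ℝ) ^ j)⁻¹ / stringProb P (h.toFun a)) with hg
  have h1 : ∀ b : Word (k * j),
      Real.logb 2 (((2 : ℝ) ^ (k * j))⁻¹ / stringProb P (h.concat k b)) =
        ∑ i, g (block b i) := by
    intro b
    rw [logb_uniform_div (stringProb_pos hP _), stringProb_concat,
      Real.logb_prod _ _ fun i _ => (stringProb_pos hP _).ne']
    simp only [hg, logb_uniform_div (stringProb_pos hP _), Finset.sum_sub_distrib,
      Finset.sum_const, Finset.card_univ, Fintype.card_fin, nsmul_eq_mul]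
    push_cast
    ring
  simp only [h1, ← Finset.mul_sum]
  rw [sum_block fun f : Fin k → Word j => ∑ i, g (f i), divergence_eq, ← Finset.mul_sum]
  have h2 := card_mul_sum_sum g k
  have hcard : (Fintype.card (Word j) : ℝ) = 2 ^ j := by simp
  rw [hcard] at h2
  have h3 : (2 : ℝ) ^ (k * j) = (2 ^ j) ^ k := by rw [← pow_mul, mul_comm]
  rw [h3]
  change _ = (k : ℝ) * (((2 : ℝ) ^ j)⁻¹ * ∑ a, g a)
  clear_value g
  field_simp
  linear_combination h2

theorem klBits_outputLaw_le (h : F2VCode j) {P : PMF Bool} (hP : ∀ b, 0 < (P b).toReal) {m : ℝ}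
    (hm0 : 0 < m) (hm : ∀ b, m ≤ (P b).toReal) (k n : ℕ) :
    klBits (outputLaw (h.encoder P k n)) (iid P n) ≤
      k * h.divergence P +
        h.overflowProb k n * (n * -Real.logb 2 m + (k * j : ℕ)) := by
  set Q : Word n → ℝ := fun v => (outputLaw (h.encoder P k n) v).toReal with hQ
  set e : Word (k * j) → Word n → ℝ := fun b v => (h.encoder P k n b v).toReal with he
  set u : ℝ := ((2 : ℝ) ^ (k * j))⁻¹ with hu
  have hu0 : 0 < u := by positivity
  have hQe : ∀ v, Q v = ∑ b, u * e b v := outputLaw_toReal _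
  have he0 : ∀ b v, 0 ≤ e b v := fun _ _ => ENNReal.toReal_nonneg
  have hsupp : ∀ {b v}, e b v ≠ 0 → v ∈ (h.encoder P k n b).support := by
    intro b v hne
    rw [PMF.mem_support_iff]
    intro h0
    exact hne (by simp [he, h0])
  have hkl : klBits (outputLaw (h.encoder P k n)) (iid P n) =
      ∑ b, u * ∑ v, e b v * Real.logb 2 (Q v / stringProb P (List.ofFn v)) := by
    rw [klBits_iid_eq]
    simp only [Finset.mul_sum]
    rw [Finset.sum_comm]
    refine Finset.sum_congr rfl fun v _ => ?_
    change Q v * _ = _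
    conv_lhs => rw [hQe v, Finset.sum_mul]
    exact Finset.sum_congr rfl fun b _ => mul_assoc _ _ _
  have hinner : ∀ b, ∑ v, e b v * Real.logb 2 (Q v / stringProb P (List.ofFn v)) ≤
      Real.logb 2 (u / stringProb P (h.concat k b)) +
        if n < (h.concat k b).length then n * -Real.logb 2 m + (k * j : ℕ) else 0 := by
    intro b
    have hsum : ∀ x : ℝ, ∑ v, e b v * x = x := fun x => by
      rw [← Finset.sum_mul, sum_toReal_eq_one, one_mul]
    split_ifs with hb
    -- On overflow the code-word term is kept on the right although it may be negative; the summand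
    -- `k * j` compensates for it.
    · have h1 : -((k * j : ℕ) : ℝ) ≤ Real.logb 2 (u / stringProb P (h.concat k b)) := by
        rw [hu, logb_uniform_div (stringProb_pos hP _)]
        have := Real.logb_nonpos one_lt_two (stringProb_pos hP (h.concat k b)).le
          (stringProb_le_one hP _)
        linarith
      have h2 : ∑ v, e b v * Real.logb 2 (Q v / stringProb P (List.ofFn v)) ≤
          n * -Real.logb 2 m := by
        rw [← hsum (n * -Real.logb 2 m)]
        refine Finset.sum_le_sum fun v _ => ?_
        rcases (he0 b v).eq_or_lt with h0 | h0
        · simp [← h0]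
        gcongr
        have hQ0 : 0 < Q v := by
          rw [hQe]
          exact Finset.sum_pos' (fun b _ => mul_nonneg hu0.le (he0 b v))
            ⟨b, Finset.mem_univ b, mul_pos hu0 h0⟩
        have h3 : m ^ n ≤ stringProb P (List.ofFn v) := by
          have := pow_le_weight hm0.le hm (List.ofFn v)
          rwa [List.length_ofFn] at this
        have h4 := Real.logb_le_logb_of_le one_lt_two (by positivity) h3
        rw [Real.logb_pow] at h4
        have h5 : Real.logb 2 (Q v) ≤ 0 :=
          Real.logb_nonpos one_lt_two hQ0.le (toReal_apply_le_one _ _)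
        rw [Real.logb_div hQ0.ne' (stringProb_pos hP _).ne']
        linarith
      linarith
    · rw [add_zero]
      conv_rhs => rw [← hsum (Real.logb 2 (u / stringProb P (h.concat k b)))]
      refine Finset.sum_le_sum fun v _ => ?_
      rcases (he0 b v).eq_or_lt with h0 | h0
      · simp [← h0]
      have hv := hsupp h0.ne'
      -- No other input produces `v`, and the filling probability occurs in numerator and
      -- denominator alike, so it cancels.
      have hQv : Q v = u * e b v := by
        rw [hQe, Finset.sum_eq_single b]
        · intro b' _ hbb'
          by_contra hne
          exact hbb' (eq_of_mem_support hv (not_lt.1 hb) (hsupp (right_ne_zero_of_mul hne))).symm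
        · simp
      rw [hQv, stringProb_ofFn_of_mem_support hv (not_lt.1 hb)]
      change e b v * Real.logb 2 (u * e b v / (_ * e b v)) ≤ _
      rw [mul_div_mul_right _ _ h0.ne']
  rw [hkl, ← sum_logb_concat h hP, ← sum_overflow, ← Finset.sum_add_distrib]
  refine Finset.sum_le_sum fun b _ => ?_
  rw [← mul_add]
  exact mul_le_mul_of_nonneg_left (hinner b) hu0.le

end F2VCode

/-! ### Achieving the entropy -/

lemma errorProb_nonneg {m n : ℕ} (enc : Word m → PMF (Word n))
    (dec : Word n → Option (Word m)) : 0 ≤ errorProb enc dec :=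
  Finset.sum_nonneg fun _ _ => mul_nonneg (by positivity)
    (Finset.sum_nonneg fun _ _ => ENNReal.toReal_nonneg)

/-- A diagonal argument: a parameter can grow slowly enough to keep a property that holds
eventually for each of its values. -/
lemma exists_tendsto_atTop_eventually {C : ℕ → ℕ → Prop} (hC : ∀ J, ∀ᶠ n in atTop, C J n) :
    ∃ j : ℕ → ℕ, Tendsto j atTop atTop ∧ ∀ᶠ n in atTop, C (j n) n := by
  classical
  let p : ℕ → ℕ → Prop := fun n J => ∀ n' ≥ n, C J n'
  have hp : ∀ J, ∀ᶠ n in atTop, p n J := fun J => by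
    obtain ⟨N, hN⟩ := eventually_atTop.1 (hC J)
    exact eventually_atTop.2 ⟨N, fun n hn n' hn' => hN n' (hn.trans hn')⟩
  refine ⟨fun n => Nat.findGreatest (p n) n, tendsto_atTop.2 fun J => ?_, ?_⟩
  · filter_upwards [hp J, eventually_ge_atTop J] with n hn hJ
    exact Nat.le_findGreatest hJ hn
  · filter_upwards [hp 0] with n hn
    -- The greatest admissible value defaults to `0`, so the property has to be known there.
    exact Nat.findGreatest_spec (P := p n) (Nat.zero_le n) hn n le_rfl

namespace F2VCode

theorem exists_achievesRate {P : PMF Bool} (hP : ∀ b, 0 < (P b).toReal) {h : ∀ j, F2VCode j}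
    (hopt : ∀ᶠ j in atTop, (h j).IsOptimal P) :
    ∃ (ε : ℕ → ℝ) (j k : ℕ → ℕ),
      (∀ n, 0 < ε n) ∧ Tendsto ε atTop (𝓝 0) ∧
      Tendsto j atTop atTop ∧ Tendsto k atTop atTop ∧
      (∀ᶠ n : ℕ in atTop, (n : ℝ) = (1 + ε n) * k n * (h (j n)).meanLength) ∧
      AchievesRate P (entropyBits P) (fun n => k n * j n)
        (fun n => (h (j n)).encoder P (k n) n)
        (fun n => (h (j n)).totalDecoder P (k n) n) := by
  classical
  let δ : ℕ → ℝ := fun J => 1 / ((J : ℝ) + 1)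
  have hδ0 : ∀ J, 0 < δ J := fun J => by positivity
  have hδ1 : ∀ J, δ J ≤ 1 := fun J => by
    simp only [δ]
    rw [div_le_one (by positivity)]
    linarith [Nat.cast_nonneg (α := ℝ) J]
  have hδlim : Tendsto δ atTop (𝓝 0) := tendsto_one_div_add_atTop_nhds_zero_nat
  have hE : ∀ J, 0 < (h J).meanLength := fun J => (h J).meanLength_pos
  have hδE : ∀ J, 0 < (1 + δ J) * (h J).meanLength := fun J =>
    mul_pos (by linarith [hδ0 J]) (hE J)
  let κ : ℕ → ℕ → ℕ := fun J n => ⌊(n : ℝ) / ((1 + δ J) * (h J).meanLength)⌋₊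
  -- Chebyshev gives `4 ^ J / (δ ^ 2 * k)`, which this threshold pushes below `δ J = 1 / (J + 1)`.
  -- It also ensures `δ * k ≥ 1`.
  let C : ℕ → ℕ → Prop := fun J n => (J + 1) ^ 3 * 4 ^ J ≤ κ J n
  have hC : ∀ J, ∀ᶠ n in atTop, C J n := fun J => by
    have : Tendsto (κ J) atTop atTop :=
      tendsto_nat_floor_atTop.comp (tendsto_natCast_atTop_atTop.atTop_div_const (hδE J))
    exact this.eventually_ge_atTop _
  obtain ⟨j, hj, hjC⟩ := exists_tendsto_atTop_eventually hC
  let k : ℕ → ℕ := fun n => κ (j n) n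
  have hCk : ∀ n, C (j n) n → j n + 1 ≤ k n := by
    intro n hn
    refine le_trans ?_ hn
    calc j n + 1 ≤ (j n + 1) ^ 3 := Nat.le_self_pow (by norm_num) _
      _ ≤ _ := Nat.le_mul_of_pos_right _ (by positivity)
  -- Solved from `n = (1 + ε) * k * E[ℓ]`, so rounding `k` down puts `ε` between `δ` and `3 * δ`;
  -- the value `1` for the other `n` only keeps `ε` positive.
  let ε : ℕ → ℝ := fun n =>
    if C (j n) n then (n : ℝ) / (k n * (h (j n)).meanLength) - 1 else 1
  have hkpos : ∀ n, C (j n) n → (0 : ℝ) < k n := fun n hn =>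
    Nat.cast_pos.2 ((Nat.succ_pos _).trans_le (hCk n hn))
  have hεeq : ∀ n, C (j n) n → (n : ℝ) = (1 + ε n) * k n * (h (j n)).meanLength := by
    intro n hn
    have := hkpos n hn
    have := hE (j n)
    simp only [ε, if_pos hn]
    field_simp
    ring
  have hεlow : ∀ n, C (j n) n → δ (j n) ≤ ε n := by
    intro n hn
    have hfl : (k n : ℝ) ≤ n / ((1 + δ (j n)) * (h (j n)).meanLength) :=
      Nat.floor_le (by have := hδE (j n); positivity)
    rw [le_div_iff₀ (hδE _)] at hfl
    simp only [ε, if_pos hn]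
    rw [le_sub_iff_add_le, le_div_iff₀ (mul_pos (hkpos n hn) (hE _))]
    linarith
  have hεup : ∀ n, C (j n) n → ε n ≤ 3 * δ (j n) := by
    intro n hn
    have hfl : (n : ℝ) / ((1 + δ (j n)) * (h (j n)).meanLength) < k n + 1 := Nat.lt_floor_add_one _
    rw [div_lt_iff₀ (hδE _)] at hfl
    have hk1 : 1 ≤ δ (j n) * k n := by
      have : (j n : ℝ) + 1 ≤ k n := by exact_mod_cast hCk n hn
      simp only [δ]
      rw [one_div, ← div_eq_inv_mul, le_div_iff₀ (by positivity)]
      linarith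
    simp only [ε, if_pos hn]
    rw [sub_le_iff_le_add, div_le_iff₀ (mul_pos (hkpos n hn) (hE _))]
    have hd0 := hδ0 (j n)
    have hd1 := hδ1 (j n)
    have hk0 := hkpos n hn
    have h1 : ((k n : ℝ) + 1) * (1 + δ (j n)) ≤ (3 * δ (j n) + 1) * k n := by nlinarith
    calc (n : ℝ) ≤ ((k n : ℝ) + 1) * (1 + δ (j n)) * (h (j n)).meanLength := by linarith
      _ ≤ (3 * δ (j n) + 1) * k n * (h (j n)).meanLength := by gcongr; exact (hE _).le
      _ = _ := by ring
  have hεpos : ∀ n, 0 < ε n := by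
    intro n
    by_cases hn : C (j n) n
    · exact (hδ0 _).trans_le (hεlow n hn)
    · simp only [ε, if_neg hn]; exact one_pos
  have hδj : Tendsto (fun n => δ (j n)) atTop (𝓝 0) := hδlim.comp hj
  have hεlim : Tendsto ε atTop (𝓝 0) := by
    have h3 : Tendsto (fun n => 3 * δ (j n)) atTop (𝓝 0) := by simpa using hδj.const_mul 3
    exact squeeze_zero' (Eventually.of_forall fun n => (hεpos n).le) (hjC.mono hεup) h3
  have hk : Tendsto k atTop atTop :=
    tendsto_atTop_mono' _ (hjC.mono fun n hn => (Nat.le_succ _).trans (hCk n hn)) hj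
  have hfac : Tendsto (fun n => 1 / (1 + ε n)) atTop (𝓝 1) := by
    have : Tendsto (fun n => 1 + ε n) atTop (𝓝 1) := by simpa using hεlim.const_add 1
    simpa using this.inv₀ one_ne_zero
  have hrate : Tendsto (fun n : ℕ => ((k n * j n : ℕ) : ℝ) / n) atTop (𝓝 (entropyBits P)) := by
    have h1 := ((tendsto_div_meanLength hP hopt).comp hj).mul hfac
    rw [mul_one] at h1
    refine h1.congr' (hjC.mono fun n hn => ?_)
    have := hkpos n hn
    have := hE (j n)
    have : 0 < 1 + ε n := by linarith [hεpos n]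
    simp only [Function.comp_apply]
    rw [hεeq n hn]
    push_cast
    field_simp
  have hov : Tendsto (fun n => (h (j n)).overflowProb (k n) n) atTop (𝓝 0) := by
    refine squeeze_zero' (Eventually.of_forall fun n => overflowProb_nonneg _ _ _)
      (hjC.mono fun n hn => ?_) hδj
    have hk0 := hkpos n hn
    have hkn : 0 < k n := Nat.cast_pos.1 hk0
    refine ((h (j n)).overflowProb_le_atypicalProb (hεeq n hn).symm.le).trans
      ((atypicalProb_le (hεpos n) hkn _).trans ?_)
    have hd0 := hδ0 (j n)
    have h1 : (4 : ℝ) ^ j n ≤ δ (j n) * (δ (j n) ^ 2 * k n) := by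
      have h2 : ((j n : ℝ) + 1) ^ 3 * 4 ^ j n ≤ k n := by exact_mod_cast hn
      have h3 : δ (j n) * (δ (j n) ^ 2 * k n) = k n / ((j n : ℝ) + 1) ^ 3 := by
        simp only [δ]; field_simp
      rw [h3, le_div_iff₀ (by positivity)]
      linarith
    rw [div_le_iff₀ (mul_pos (pow_pos (hεpos n) 2) hk0)]
    refine h1.trans ?_
    have := hεlow n hn
    gcongr
  refine ⟨ε, j, k, hεpos, hεlim, hj, hk, hjC.mono hεeq, hrate, ?_, ?_⟩
  · set m := min (P false).toReal (P true).toReal with hm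
    have hm0 : 0 < m := lt_min (hP false) (hP true)
    have hmb : ∀ b, m ≤ (P b).toReal := by
      rintro (_ | _)
      · exact min_le_left _ _
      · exact min_le_right _ _
    have hlim : Tendsto (fun n : ℕ => (h (j n)).divergence P / (h (j n)).meanLength *
        (1 / (1 + ε n)) + (h (j n)).overflowProb (k n) n *
          (-Real.logb 2 m + ((k n * j n : ℕ) : ℝ) / n)) atTop (𝓝 0) := by
      have := (((tendsto_divergence_div_meanLength hP hopt).comp hj).mul hfac).add
        (hov.mul (hrate.const_add (-Real.logb 2 m)))
      simpa using this
    refine squeeze_zero' (Eventually.of_forall fun n =>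
      div_nonneg (klBits_iid_nonneg hP _) (Nat.cast_nonneg n)) ?_ hlim
    filter_upwards [hjC, eventually_gt_atTop 0] with n hn hn0
    have hn0' : (0 : ℝ) < n := Nat.cast_pos.2 hn0
    rw [div_le_iff₀ hn0']
    refine ((h (j n)).klBits_outputLaw_le hP hm0 hmb (k n) n).trans (le_of_eq ?_)
    have h1 : (k n : ℝ) * (h (j n)).divergence P =
        (h (j n)).divergence P / (h (j n)).meanLength * (1 / (1 + ε n)) * n := by
      have := hkpos n hn
      have := hE (j n)
      have : 0 < 1 + ε n := by linarith [hεpos n]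
      conv_rhs => rw [hεeq n hn]
      field_simp
    rw [h1]
    field_simp
  · refine squeeze_zero (fun n => ?_) (fun n => errorProb_le_overflowProb _ P _ _ ?_) hov
    · exact errorProb_nonneg _ _
    · intro b hb v hv
      simp only [totalDecoder, decoder_eq_some hv hb, Option.getD_some]

end F2VCode

/-! ### The converse -/

lemma entropyBits_nonneg {P : PMF Bool} (hP : ∀ b, 0 < (P b).toReal) : 0 ≤ entropyBits P := by
  rw [entropyBits, ← Finset.sum_neg_distrib]
  refine Finset.sum_nonneg fun b _ => ?_
  have := Real.logb_nonpos one_lt_two (hP b).le (toReal_apply_le_one P b)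
  rw [← mul_neg]
  exact mul_nonneg (hP b).le (by linarith)

/-- The probability that the output of a matcher lies in a set is at most the error probability
plus the number of elements of the set relative to the number of inputs. -/
lemma sum_outputLaw_le {m n : ℕ} (enc : Word m → PMF (Word n)) (dec : Word n → Word m)
    (A : Finset (Word n)) :
    ∑ v ∈ A, (outputLaw enc v).toReal ≤
      errorProb enc (fun v => some (dec v)) + A.card * ((2 : ℝ) ^ m)⁻¹ := by
  have hu : (0 : ℝ) < ((2 : ℝ) ^ m)⁻¹ := by positivity
  -- Each output decodes to exactly one input, so it can be correct for one `b` only.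
  have hcard : (A.card : ℝ) * ((2 : ℝ) ^ m)⁻¹ =
      ∑ b : Word m, ((2 : ℝ) ^ m)⁻¹ * ∑ v ∈ A, if dec v = b then (1 : ℝ) else 0 := by
    rw [← Finset.mul_sum, Finset.sum_comm]
    simp [mul_comm]
  simp only [outputLaw_toReal]
  rw [Finset.sum_comm, hcard, errorProb, ← Finset.sum_add_distrib]
  refine Finset.sum_le_sum fun b _ => ?_
  rw [← Finset.mul_sum, ← mul_add]
  refine mul_le_mul_of_nonneg_left ?_ hu.le
  rw [Finset.sum_filter]
  have h1 : ∑ v ∈ A, (if some (dec v) ≠ some b then (enc b v).toReal else 0) ≤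
      ∑ v, if some (dec v) ≠ some b then (enc b v).toReal else 0 :=
    Finset.sum_le_sum_of_subset_of_nonneg (Finset.subset_univ A) fun v _ _ => by
      split_ifs
      · exact ENNReal.toReal_nonneg
      · exact le_rfl
  refine le_trans ?_ (add_le_add_left h1 _)
  rw [← Finset.sum_add_distrib]
  refine Finset.sum_le_sum fun v _ => ?_
  by_cases hv : dec v = b
  · simp [hv, toReal_apply_le_one]
  · simp [hv]

theorem le_entropyBits_of_isAchievable {P : PMF Bool} (hP : ∀ b, 0 < (P b).toReal) {R : ℝ}
    (hR : IsAchievable P R) : R ≤ entropyBits P := by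
  obtain ⟨m, enc, dec, hrate, hkl, herr⟩ := hR
  by_contra! hlt
  set H := entropyBits P with hH
  have hH0 : 0 ≤ H := entropyBits_nonneg hP
  -- Thirds leave `H + 2 * δ < R`: one `δ` sets the threshold of `A`, the other makes `A`
  -- exponentially small relative to the number of inputs.
  obtain ⟨δ, hδ⟩ : ∃ δ, δ = (R - H) / 3 := ⟨_, rfl⟩
  have hδ0 : 0 < δ := by rw [hδ]; linarith
  obtain ⟨η, hη, hself⟩ := exists_abs_selfInformation_sub_le hP (half_pos hδ0)
  have hpow : Tendsto (fun n : ℕ => ((2 : ℝ) ^ (-δ)) ^ n) atTop (𝓝 0) :=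
    tendsto_pow_atTop_nhds_zero_of_lt_one (by positivity)
      (Real.rpow_lt_one_of_one_lt_of_neg one_lt_two (by linarith))
  have hlim : Tendsto (fun n : ℕ => (1 - (errorProb (enc n) (fun v => some (dec n v)) +
      ((2 : ℝ) ^ (-δ)) ^ n)) * (H + δ)) atTop (𝓝 (H + δ)) := by
    have := ((herr.add hpow).const_sub 1).mul_const (H + δ)
    simpa using this
  -- The mean self-information per letter is at least nearly `H + δ` by decodability and at most `H
  -- + δ / 2` by small divergence.
  have hle : H + δ ≤ H + δ / 2 := by
    refine le_of_tendsto hlim ?_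
    filter_upwards [hkl.eventually_lt_const hη,
      hrate.eventually_const_lt (show H + 2 * δ < R by rw [hδ]; linarith),
      eventually_gt_atTop 0] with n hn1 hn2 hn0
    have hn : (0 : ℝ) < n := Nat.cast_pos.2 hn0
    rw [div_lt_iff₀ hn] at hn1
    rw [lt_div_iff₀ hn] at hn2
    set Q : Word n → ℝ := fun v => (outputLaw (enc n) v).toReal with hQ
    have hQ0 : ∀ v, 0 ≤ Q v := fun _ => ENNReal.toReal_nonneg
    have hQ1 : ∑ v, Q v = 1 := sum_toReal_eq_one _
    have hX := hself (Word n) Q (fun v => List.ofFn v) hQ0 hQ1 (isKraft_ofFn n)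
    simp only [List.length_ofFn, ← Finset.sum_mul, hQ1, one_mul] at hX
    rw [← klBits_iid_eq] at hX
    have hX2 := (abs_le.1 (hX hn1.le)).2
    let A : Finset (Word n) := Finset.univ.filter fun v =>
      -Real.logb 2 (stringProb P (List.ofFn v)) ≤ n * (H + δ)
    -- Each member of `A` has probability at least `2 ^ (-n(H + δ))`, and these sum to at most one.
    have hAcard : (A.card : ℝ) ≤ (2 : ℝ) ^ ((n : ℝ) * (H + δ)) := by
      have h1 : (A.card : ℝ) * (2 : ℝ) ^ (-((n : ℝ) * (H + δ))) ≤ 1 := by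
        rw [← nsmul_eq_mul, ← sum_stringProb_ofFn P n]
        refine (Finset.card_nsmul_le_sum A _ _ fun v hv => ?_).trans
          (Finset.sum_le_sum_of_subset_of_nonneg (Finset.subset_univ A)
            fun v _ _ => (stringProb_pos hP _).le)
        have := (Finset.mem_filter.1 hv).2
        rw [← Real.le_logb_iff_rpow_le one_lt_two (stringProb_pos hP _)]
        linarith
      rwa [Real.rpow_neg two_pos.le, ← div_eq_mul_inv, div_le_one (by positivity)] at h1
    have hAm : (A.card : ℝ) * ((2 : ℝ) ^ (m n))⁻¹ ≤ ((2 : ℝ) ^ (-δ)) ^ n := by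
      calc (A.card : ℝ) * ((2 : ℝ) ^ (m n))⁻¹
          ≤ (2 : ℝ) ^ ((n : ℝ) * (H + δ)) * ((2 : ℝ) ^ (m n))⁻¹ := by gcongr
        _ = (2 : ℝ) ^ ((n : ℝ) * (H + δ) - m n) := by
            rw [Real.rpow_sub two_pos, Real.rpow_natCast, div_eq_mul_inv]
        _ ≤ (2 : ℝ) ^ (-δ * n) := by
            refine Real.rpow_le_rpow_of_exponent_le one_le_two ?_
            linarith
        _ = _ := Real.rpow_mul_natCast two_pos.le _ _
    have hQA := sum_outputLaw_le (enc n) (dec n) A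
    have hcompl : ∑ v ∈ A, Q v + ∑ v ∈ Aᶜ, Q v = 1 := by
      rw [Finset.sum_add_sum_compl, hQ1]
    have hlow : (∑ v ∈ Aᶜ, Q v) * (n * (H + δ)) ≤
        ∑ v, Q v * -Real.logb 2 (stringProb P (List.ofFn v)) := by
      rw [Finset.sum_mul]
      refine (Finset.sum_le_sum fun v hv => ?_).trans
        (Finset.sum_le_sum_of_subset_of_nonneg (Finset.subset_univ Aᶜ) fun v _ _ => ?_)
      · have : ¬ (-Real.logb 2 (stringProb P (List.ofFn v)) ≤ n * (H + δ)) := by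
          simpa [A] using hv
        exact mul_le_mul_of_nonneg_left (not_le.1 this).le (hQ0 v)
      · have := Real.logb_nonpos one_lt_two (stringProb_pos hP (List.ofFn v)).le
          (stringProb_le_one hP _)
        exact mul_nonneg (hQ0 v) (by linarith)
    have hQA2 : 1 - (errorProb (enc n) (fun v => some (dec n v)) + ((2 : ℝ) ^ (-δ)) ^ n) ≤
        ∑ v ∈ Aᶜ, Q v := by
      linarith [hQA, hcompl, hAm]
    refine le_of_mul_le_mul_right ?_ hn
    calc _ ≤ (∑ v ∈ Aᶜ, Q v) * (H + δ) * n := by gcongr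
      _ = (∑ v ∈ Aᶜ, Q v) * (n * (H + δ)) := by ring
      _ ≤ _ := hlow
      _ ≤ (H + δ / 2) * n := by linarith
  linarith

/-! ### Error probability and rate for a fixed code -/

namespace F2VCode

variable {j : ℕ}

theorem errorProb_le_atypicalProb (h : F2VCode j) (P : PMF Bool) {ε : ℝ} {k n : ℕ}
    (hn : (1 + ε) * k * h.meanLength ≤ n) :
    errorProb (h.encoder P k n) (h.decoder P k n) ≤ atypicalProb ε k j :=
  (h.errorProb_le_overflowProb P k n fun _ hb _ hv => decoder_eq_some hv hb).trans
    (h.overflowProb_le_atypicalProb hn)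

theorem tendsto_rate_outputLength (h : F2VCode j) {ε : ℝ} (hε : 0 < ε) :
    Tendsto (fun k : ℕ => ((k * j : ℕ) : ℝ) / (h.outputLength ε k)) atTop
      (𝓝 (j / ((1 + ε) * h.meanLength))) := by
  have ha : 0 < (1 + ε) * h.meanLength := mul_pos (by linarith) h.meanLength_pos
  have h1 : Tendsto (fun k : ℕ => (⌈(1 + ε) * h.meanLength * (k : ℝ)⌉₊ : ℝ) / (k : ℝ)) atTop
      (𝓝 ((1 + ε) * h.meanLength)) :=
    (tendsto_nat_ceil_mul_div_atTop ha.le).comp tendsto_natCast_atTop_atTop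
  refine (Tendsto.div tendsto_const_nhds h1 ha.ne').congr fun k => ?_
  rw [outputLength, mul_right_comm, Pi.div_apply, Nat.cast_mul, div_div_eq_mul_div, mul_comm]

end F2VCode

end DistMatch

open DistMatch in
theorem mainTheorem4 (P : PMF Bool) (hP0 : 0 < P false) (hP1 : P false < 1) :
    -- optimal codes exist for all sufficiently large input lengths
    (∀ᶠ j in atTop, ∃ h : F2VCode j, h.IsOptimal P) ∧
    -- the matcher built on any prefix-free code, with any `ε > 0`
    (∀ (ε : ℝ), 0 < ε → ∀ (j : ℕ) (h : F2VCode j),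
      -- the decoder inverts the encoder without overflow and declares an error otherwise
      (∀ (k n : ℕ) (b : Word (k * j)) (v : Word n), v ∈ (h.encoder P k n b).support →
        ((h.concat k b).length ≤ n → h.decoder P k n v = some b) ∧
        (n < (h.concat k b).length → h.decoder P k n v = none)) ∧
      -- error probability at `n = (1 + ε) k E[ℓ(U)]` (or any larger integer)
      (∀ k n : ℕ, (1 + ε) * k * h.meanLength ≤ n →
        errorProb (h.encoder P k n) (h.decoder P k n) ≤ atypicalProb ε k j) ∧
      Tendsto (fun k => atypicalProb ε k j) atTop (𝓝 0) ∧
      Tendsto (fun k => errorProb (h.encoder P k (h.outputLength ε k))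
        (h.decoder P k (h.outputLength ε k))) atTop (𝓝 0) ∧
      -- rate
      (∀ k n : ℕ, 0 < k → (n : ℝ) = (1 + ε) * k * h.meanLength →
        ((k * j : ℕ) : ℝ) / n = j / ((1 + ε) * h.meanLength)) ∧
      Tendsto (fun k : ℕ => ((k * j : ℕ) : ℝ) / (h.outputLength ε k)) atTop
        (𝓝 (j / ((1 + ε) * h.meanLength)))) ∧
    -- the matcher built on optimal codes
    (∀ h : ∀ j, F2VCode j, (∀ᶠ j in atTop, (h j).IsOptimal P) →
      (∀ ε : ℝ, 0 < ε →
        Tendsto (fun j : ℕ => (j : ℝ) / ((1 + ε) * (h j).meanLength)) atTop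
          (𝓝 (entropyBits P / (1 + ε)))) ∧
      -- with `ε → 0` and `j, k → ∞` it achieves the rate `H(P_Y)`
      ∃ (ε : ℕ → ℝ) (j k : ℕ → ℕ),
        (∀ n, 0 < ε n) ∧ Tendsto ε atTop (𝓝 0) ∧
        Tendsto j atTop atTop ∧ Tendsto k atTop atTop ∧
        (∀ᶠ n : ℕ in atTop, (n : ℝ) = (1 + ε n) * k n * (h (j n)).meanLength) ∧
        AchievesRate P (entropyBits P) (fun n => k n * j n)
          (fun n => (h (j n)).encoder P (k n) n)
          (fun n => (h (j n)).totalDecoder P (k n) n)) ∧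
    -- and this rate is the maximum achievable one
    IsGreatest {R : ℝ | IsAchievable P R} (entropyBits P) := by
  have hP := toReal_pos_of_lt hP0 hP1
  refine ⟨F2VCode.eventually_exists_isOptimal hP, ?_, ?_, ?_, ?_⟩
  · intro ε hε j h
    refine ⟨fun k n b v hv => ⟨F2VCode.decoder_eq_some hv, F2VCode.decoder_eq_none hv⟩,
      fun k n hn => h.errorProb_le_atypicalProb P hn, tendsto_atypicalProb hε j, ?_, ?_,
      h.tendsto_rate_outputLength hε⟩
    · exact squeeze_zero (fun k => errorProb_nonneg _ _)
        (fun k => h.errorProb_le_atypicalProb P (Nat.le_ceil _)) (tendsto_atypicalProb hε j)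
    · intro k n hk hn
      have hk0 : (0 : ℝ) < k := Nat.cast_pos.2 hk
      rw [hn, mul_right_comm, mul_comm _ (k : ℝ), Nat.cast_mul, mul_div_mul_left _ _ hk0.ne']
  · intro h hopt
    refine ⟨fun ε hε => ?_, F2VCode.exists_achievesRate hP hopt⟩
    refine ((F2VCode.tendsto_div_meanLength hP hopt).div_const (1 + ε)).congr fun j => ?_
    rw [div_div, mul_comm]
  · have hex : ∃ h : ∀ j, F2VCode j, ∀ᶠ j in atTop, (h j).IsOptimal P := by
      classical
      -- `trivialCode` fills in the small `j` for which no optimal code need exist.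
      refine ⟨fun j => if hj : ∃ h : F2VCode j, h.IsOptimal P then hj.choose
        else F2VCode.trivialCode j, ?_⟩
      filter_upwards [F2VCode.eventually_exists_isOptimal hP] with j hj
      rw [dif_pos hj]
      exact hj.choose_spec
    obtain ⟨h, hopt⟩ := hex
    obtain ⟨ε, j, k, -, -, -, -, -, hach⟩ := F2VCode.exists_achievesRate hP hopt
    exact ⟨_, _, _, hach⟩
  · exact fun R hR => le_entropyBits_of_isAchievable hP hR
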